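/- Let $n\ge 1$ and $\alpha_1,\dots,\alpha_n\in(0,\pi)$ (indices cyclic), and let $\omega=\sum_i\alpha_i$. Glue $n$ infinite angular regions $A_1,\dots,A_n$ of angles $\alpha_1,\dots,\alpha_n$ along their sides in this cyclic order to obtain the Euclidean cone $C_\omega$ of angle $\omega$. Let $\nu_i$ be the unit vector from the apex along the ray separating $A_i$ from $A_{i+1}$. For $x\in\mathbb R^n$ with all $x_i>0$, let $L_i=\{p:\langle p,\nu_i\rangle=x_i\}$ be the line orthogonal to $\nu_i$ at distance $x_i$ from the apex (drawn in a development of $C_\omega$ into the plane along $\nu_i$), oriented from $A_i$ into $A_{i+1}$, and let $\ell_i(x)$ be the signed length of the segment of $L_i$ from $L_{i-1}\cap L_i$ to $L_i\cap L_{i+1}$, these intersections being taken after developing $A_i\cup A_{i+1}$ into the plane. If all $\ell_i(x)>0$, these segments form a closed polygonal line on $C_\omega$, called the convex polygon with exterior normals $\nu_1,\dots,\nu_n$ and support numbers $x_1,\dots,x_n$; its perimeter is the sum of the lengths of the sides, and its area is the area of the region it encloses, which is the union of the triangles spanned by the apex and the sides. Two polygons have the same side directions if they have the same exterior normals $\nu_i$.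 Call a convex polygon optimal if it has the largest area among all convex polygons with the same side directions and the same perimeter. Call it circumscribed if all its sides are tangent to a circle of some radius $r>0$ centered at the apex. Then, for the fixed side directions $\nu_1,\dots,\nu_n$: 1. For every $r>0$ there is exactly one polygon whose sides are tangent to the circle of radius $r$ centered at the apex. 2. If $\omega\le 2\pi$, every circumscribed polygon is optimal. 3. If $\omega<2\pi$, then for every $L>0$ there is exactly one optimal polygon of perimeter $L$. 4. If $\omega=2\pi$ (so that $C_\omega$ is the Euclidean plane), then for every $L>0$ there is an optimal polygon of perimeter $L$, and it is unique up to translation: if $P$ is optimal, then a polygon $Q$ is optimal with the same perimeter as $P$ if and only if $Q$ is a translate of $P$. 5. If $\omega>2\pi$, no circumscribed polygon is optimal. -/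

import Mathlib

open scoped NNReal ENNReal

noncomputable section

/-- Polar coordinates `(r, θ)` describe the same point of the cone of angle `ω` iff the radii agree
and, away from the apex, the angles agree modulo `ω`. -/
def coneSetoid (ω : ℝ) : Setoid (ℝ≥0 × ℝ) where
  r p q := p.1 = q.1 ∧ (p.1 = 0 ∨ (p.2 : AddCircle ω) = (q.2 : AddCircle ω))
  iseqv :=
    { refl := fun _ => ⟨rfl, Or.inr rfl⟩
      symm := fun h => ⟨h.1.symm, h.2.imp (fun h0 => h.1 ▸ h0) Eq.symm⟩
      trans := by
        rintro x y z ⟨h1, h2⟩ ⟨h3, h4⟩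
        refine ⟨h1.trans h3, ?_⟩
        rcases h2 with h2 | h2
        · exact Or.inl h2
        · exact h4.imp (fun h => h1.trans h) (fun h => h2.trans h) }

/-- The euclidean cone `C_ω`: the angular region of size `ω`, in polar coordinates, with its two
sides glued isometrically. For `ω > 2π` this is the result of pasting several smaller regions. -/
def Cone (ω : ℝ) : Type := Quotient (coneSetoid ω)

namespace Cone

instance (ω : ℝ) : MeasurableSpace (Cone ω) :=
  inferInstanceAs (MeasurableSpace (Quotient (coneSetoid ω)))

/-- The point of `C_ω` with polar coordinates `(r, θ)`. -/
def polar (ω : ℝ) (r : ℝ≥0) (θ : ℝ) : Cone ω := Quotient.mk (coneSetoid ω) (r, θ)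

theorem measurable_polar (ω : ℝ) :
    Measurable (fun p : ℝ × ℝ => polar ω p.1.toNNReal p.2) := by
  have h : Measurable (Quotient.mk (coneSetoid ω)) := fun _ hs => hs
  exact h.comp ((measurable_real_toNNReal.comp measurable_fst).prodMk measurable_snd)

/-- The area measure of `C_ω`: the image of `r dr dθ` on the angular region of size `ω`. -/
def areaMeasure (ω : ℝ) : MeasureTheory.Measure (Cone ω) :=
  MeasureTheory.Measure.map (fun p : ℝ × ℝ => polar ω p.1.toNNReal p.2)
    ((MeasureTheory.volume.restrict (Set.Ioi (0 : ℝ) ×ˢ Set.Ico (0 : ℝ) ω)).withDensity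
      (fun p => ENNReal.ofReal p.1))

/-- The inverse of the development of `C_ω` into the plane that sends the apex to `0` and the ray of
angle `θ` to the positive real axis. It is a local isometry on the plane minus the nonpositive
real axis. -/
def ofPlane (ω : ℝ) (θ : ℝ) (z : ℂ) : Cone ω := polar ω ‖z‖₊ (θ + Complex.arg z)

end Cone

/-- The line `{z | ⟨z, u⟩ = c}` in the plane. -/
def supportLine (u : ℂ) (c : ℝ) : Set ℂ := {z | inner ℝ z u = c}

section Development

variable {n : ℕ} [NeZero n]

/-- The angle `ω` of the cone glued from the angular regions `A_i` of angles `α i`. -/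
def totalAngle (α : Fin n → ℝ) : ℝ := ∑ i, α i

/-- The angular coordinate of the ray `R_i` (spanned by the unit vector `ν_i`) that separates the
region `A_i` from the next region `A_{i+1}`; indices are cyclic. -/
def rayAngle (α : Fin n → ℝ) (i : Fin n) : ℝ := ∑ j ∈ Finset.Iic i, α j

/-- Develop `A_i ∪ A_{i+1}` into the plane so that `ν_i` becomes `1`, hence
`ν_{i-1} = exp (-α_i I)` and `ν_{i+1} = exp (α_{i+1} I)`, with lines `L_j = {z | ⟨z, ν_j⟩ = x_j}`.
This is the intersection point of `L_i` with `L_{i-1}`, see `supportLine_inter_prev`. -/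
def startPoint (α x : Fin n → ℝ) (i : Fin n) : ℂ :=
  ⟨x i, (x i * Real.cos (α i) - x (i - 1)) / Real.sin (α i)⟩

/-- In the same development, the intersection point of `L_i` with `L_{i+1}`,
see `supportLine_inter_next`. -/
def endPoint (α x : Fin n → ℝ) (i : Fin n) : ℂ :=
  ⟨x i, (x (i + 1) - x i * Real.cos (α (i + 1))) / Real.sin (α (i + 1))⟩

theorem supportLine_inter_prev (α x : Fin n → ℝ) (hα : ∀ i, α i ∈ Set.Ioo 0 Real.pi) (i : Fin n) :
    supportLine 1 (x i) ∩ supportLine (Complex.exp (-(α i : ℂ) * Complex.I)) (x (i - 1)) =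
      {startPoint α x i} := by
  have hs := (Real.sin_pos_of_mem_Ioo (hα i)).ne'
  ext z
  simp only [supportLine, startPoint, Set.mem_inter_iff, Set.mem_ofPred_eq, Set.mem_singleton_iff,
    Complex.ext_iff, Complex.inner, ← Complex.ofReal_neg, Complex.mul_re, Complex.conj_re,
    Complex.conj_im, Complex.exp_ofReal_mul_I_re, Complex.exp_ofReal_mul_I_im, Real.cos_neg,
    Real.sin_neg, Complex.one_re, Complex.one_im]
  rw [eq_div_iff hs]
  constructor
  · rintro ⟨h1, h2⟩
    have h1 : z.re = x i := by linarith
    rw [h1] at h2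
    exact ⟨h1, by linarith⟩
  · rintro ⟨h1, h2⟩
    rw [h1]
    exact ⟨by ring, by linarith⟩

theorem supportLine_inter_next (α x : Fin n → ℝ) (hα : ∀ i, α i ∈ Set.Ioo 0 Real.pi) (i : Fin n) :
    supportLine 1 (x i) ∩ supportLine (Complex.exp ((α (i + 1) : ℂ) * Complex.I)) (x (i + 1)) =
      {endPoint α x i} := by
  have hs := (Real.sin_pos_of_mem_Ioo (hα (i + 1))).ne'
  ext z
  simp only [supportLine, endPoint, Set.mem_inter_iff, Set.mem_ofPred_eq, Set.mem_singleton_iff,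
    Complex.ext_iff, Complex.inner, Complex.mul_re, Complex.conj_re,
    Complex.conj_im, Complex.exp_ofReal_mul_I_re, Complex.exp_ofReal_mul_I_im,
    Complex.one_re, Complex.one_im]
  rw [eq_div_iff hs]
  constructor
  · rintro ⟨h1, h2⟩
    have h1 : z.re = x i := by linarith
    rw [h1] at h2
    exact ⟨h1, by linarith⟩
  · rintro ⟨h1, h2⟩
    rw [h1]
    exact ⟨by ring, by linarith⟩

/-- The signed length `ℓ_i` of the segment of `L_i` between its intersections with `L_{i-1}` and
`L_{i+1}`, where `L_i` is oriented from `A_i` into `A_{i+1}`, i.e. in the direction of `I`. -/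
def signedLength (α x : Fin n → ℝ) (i : Fin n) : ℝ := (endPoint α x i - startPoint α x i).im

end Development

/-- A convex polygon on the cone glued from angular regions of angles `α i`, with exterior normals
`ν_i` along the rays between consecutive regions: it is given by positive support numbers for which
all signed side lengths are positive. -/
@[ext]
structure ConvexPolygon {n : ℕ} [NeZero n] (α : Fin n → ℝ) where
  support : Fin n → ℝ
  support_pos : ∀ i, 0 < support i
  signedLength_pos : ∀ i, 0 < signedLength α support i

namespace ConvexPolygon

variable {n : ℕ} [NeZero n] {α : Fin n → ℝ}

/-- The `i`-th side in the development along `ν_i`. -/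
def devSide (P : ConvexPolygon α) (i : Fin n) : Set ℂ :=
  segment ℝ (startPoint α P.support i) (endPoint α P.support i)

/-- The `i`-th side as a subset of the cone. -/
def side (P : ConvexPolygon α) (i : Fin n) : Set (Cone (totalAngle α)) :=
  Cone.ofPlane (totalAngle α) (rayAngle α i) '' P.devSide i

/-- The region enclosed by the polygon: the union of the triangles spanned by the apex and the
sides. -/
def region (P : ConvexPolygon α) : Set (Cone (totalAngle α)) :=
  ⋃ i, Cone.ofPlane (totalAngle α) (rayAngle α i) ''
    convexHull ℝ {0, startPoint α P.support i, endPoint α P.support i}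

/-- The perimeter: the sum of the lengths of the sides. -/
def perimeter (P : ConvexPolygon α) : ℝ :=
  ∑ i, dist (startPoint α P.support i) (endPoint α P.support i)

/-- The area of the enclosed region. -/
def area (P : ConvexPolygon α) : ℝ≥0∞ := Cone.areaMeasure (totalAngle α) P.region

/-- Every side is tangent to the circle of radius `r` centered at the apex. -/
def IsCircumscribedAbout (P : ConvexPolygon α) (r : ℝ) : Prop :=
  0 < r ∧ ∀ i, ∃ q ∈ P.devSide i, (EuclideanGeometry.Sphere.mk (0 : ℂ) r).IsTangentAt q
    (line[ℝ, startPoint α P.support i, endPoint α P.support i])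

/-- The polygon has the largest area among all convex polygons with the same side directions and the
same perimeter. -/
def IsOptimal (P : ConvexPolygon α) : Prop :=
  ∀ Q : ConvexPolygon α, Q.perimeter = P.perimeter → Q.area ≤ P.area

/-- `Q` is obtained from `P` by a translation. To be used for cone angle `2π`, where
`Cone.ofPlane (2π) 0` is the isometric identification of the plane with the cone. -/
def IsTranslateOf (Q P : ConvexPolygon α) : Prop :=
  ∃ v : ℂ, ∀ i, Cone.ofPlane (totalAngle α) 0 ⁻¹' Q.side i =
    (fun z => z + v) '' (Cone.ofPlane (totalAngle α) 0 ⁻¹' P.side i)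

end ConvexPolygon

end

/-! Integrating in polar coordinates shows that the area is half of `pairing α x x`, a symmetric
quadratic form q in the support numbers, and that the perimeter is the linear functional `pairing α
1 x`. The polygon circumscribed about the circle of radius r has support vector r • 1. If Q has the
same perimeter and y is the difference of the support vectors, then `pairing α 1 y = 0`, so the
cross term vanishes and q(Q) = q(P) + q(y). All the claims therefore depend on the sign and the null
vectors of q on the hyperplane orthogonal to 1.

There -q(y) is a sum of arc energies, the integral of h'² - h² over a circle of length ω for a
function h that is trigonometric between consecutive normals and takes the values y at them. For ω =
2π its nonnegativity is a discrete Wirtinger inequality (`sum_arcEnergy_nonneg`). Other angles are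
compared with this case by multiplying every tan(α_i/2) by one factor s so that the new angles add
up to 2π. This preserves the mean-zero condition, and up to a positive factor it changes the energy
by (1 - 1/s²) times a sum of weighted squared differences. Since s ≥ 1 when ω ≤ 2π, q is nonpositive
on the hyperplane (`pairing_self_nonpos`). Since s < 1 when ω > 2π, a first harmonic for the new
angles makes q positive (`exists_pairing_self_pos`). With n ≤ 2 no such s exists, and a direct
computation suffices.

When ω ≤ 2π, a null vector of q in the hyperplane has all signed lengths zero, so all its lines pass
through one point. Such vectors are the translations if ω = 2π. If ω < 2π, the rotation by ω must
fix that point, which is then the apex, so the vector is zero. -/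

noncomputable section

/-! ### Discrete Wirtinger inequality on the circle of length 2π -/

/-- The integral of `h' ^ 2 - h ^ 2` over an arc of length `δ`, for the solution `h` of `h'' = -h`
with boundary values `p` and `q`. -/
def arcEnergy (δ p q : ℝ) : ℝ := ((p ^ 2 + q ^ 2) * Real.cos δ - 2 * p * q) / Real.sin δ

/-- Picone's identity with comparison solution sin: the energy exceeds the increment of h² cot by a
square divided by sin a · sin (a + δ) · sin δ. The square vanishes when the interpolant is a
multiple of sin. At a zero of sin the cotangent takes the junk value 0, harmless because h is
required to vanish there. -/
theorem arcEnergy_ge_of_sin_mul_sin (a δ p q : ℝ) (hδ : 0 < Real.sin δ)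
    (hp : Real.sin a = 0 → p = 0) (hq : Real.sin (a + δ) = 0 → q = 0)
    (h : 0 ≤ Real.sin a * Real.sin (a + δ) ∨ p * Real.sin (a + δ) = q * Real.sin a) :
    q ^ 2 * (Real.cos (a + δ) / Real.sin (a + δ)) - p ^ 2 * (Real.cos a / Real.sin a) ≤
      arcEnergy δ p q := by
  unfold arcEnergy
  have hsq := Real.sin_sq_add_cos_sq a
  by_cases ha : Real.sin a = 0
  · have hc : Real.cos a ≠ 0 := by
      intro h0
      rw [ha, h0] at hsq
      norm_num at hsq
    rw [hp ha, Real.sin_add, Real.cos_add, ha]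
    apply le_of_eq
    field_simp
    ring
  by_cases hb : Real.sin (a + δ) = 0
  · rw [hq hb, hb]
    rw [Real.sin_add] at hb
    have : Real.cos a = -(Real.sin a * Real.cos δ) / Real.sin δ := by
      rw [eq_div_iff hδ.ne']
      linarith
    rw [this]
    apply le_of_eq
    field_simp
    ring
  have key : ((p ^ 2 + q ^ 2) * Real.cos δ - 2 * p * q) / Real.sin δ =
      q ^ 2 * (Real.cos (a + δ) / Real.sin (a + δ)) - p ^ 2 * (Real.cos a / Real.sin a) +
      (p * Real.sin (a + δ) - q * Real.sin a) ^ 2 /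
        (Real.sin a * Real.sin (a + δ) * Real.sin δ) := by
    have e1 : Real.sin δ = Real.sin (a + δ) * Real.cos a - Real.cos (a + δ) * Real.sin a := by
      rw [← Real.sin_sub, add_sub_cancel_left]
    have e2 : Real.cos δ = Real.cos (a + δ) * Real.cos a + Real.sin (a + δ) * Real.sin a := by
      rw [← Real.cos_sub, add_sub_cancel_left]
    have hsq' := Real.sin_sq_add_cos_sq (a + δ)
    have hδ' := hδ.ne'
    have g1 : Real.sin (a + δ) = Real.sin a * Real.cos δ + Real.cos a * Real.sin δ :=
      Real.sin_add a δ
    have g2 : Real.sin a = Real.sin (a + δ) * Real.cos δ - Real.cos (a + δ) * Real.sin δ := by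
      rw [← Real.sin_sub, add_sub_cancel_right]
    generalize Real.sin (a + δ) = S at *
    generalize Real.cos (a + δ) = C at *
    generalize Real.sin a = s at *
    generalize Real.cos a = c at *
    generalize Real.sin δ = d at *
    generalize Real.cos δ = f at *
    field_simp
    linear_combination (-p ^ 2 * S) * g1 - q ^ 2 * s * g2
  rw [key]
  rcases h with h | h
  · have : 0 ≤ (p * Real.sin (a + δ) - q * Real.sin a) ^ 2 /
        (Real.sin a * Real.sin (a + δ) * Real.sin δ) := by positivity
    linarith
  · rw [h]
    simp

/-- The bounds by increments of h² cot telescope to zero. The sine changes sign only on the arc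
through π, and there `hk3` says that the interpolant vanishes at π, hence is a multiple of sin. -/
theorem sum_arcEnergy_nonneg_of_interpolant_eq_zero {n k : ℕ} (t X : ℕ → ℝ) (ht0 : t 0 = 0)
    (htn : t n = 2 * Real.pi) (hlt : ∀ j < n, t j < t (j + 1))
    (hpi : ∀ j < n, t (j + 1) < t j + Real.pi) (hX0 : X 0 = 0) (hXn : X n = 0) (hk : k < n)
    (hk1 : t k ≤ Real.pi) (hk2 : Real.pi < t (k + 1))
    (hk3 : X k * Real.sin (t (k + 1)) = X (k + 1) * Real.sin (t k)) :
    0 ≤ ∑ j ∈ Finset.range n, arcEnergy (t (j + 1) - t j) (X j) (X (j + 1)) := by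
  have hmono : ∀ j ≤ n, ∀ i ≤ j, t i ≤ t j := by
    intro j hj i hij
    induction j, hij using Nat.le_induction with
    | base => exact le_rfl
    | succ m _ ih => exact (ih (by omega)).trans (hlt m (by omega)).le
  have hsm : ∀ j ≤ n, ∀ i < j, t i < t j := fun j hj i hij =>
    (hlt i (by omega)).trans_le (hmono j hj (i + 1) hij)
  have hpos := Real.pi_pos
  have hzero : ∀ j ≤ n, Real.sin (t j) = 0 → X j = 0 := by
    intro j hj hs
    rcases Nat.eq_zero_or_pos j with rfl | hj0
    · exact hX0
    rcases hj.eq_or_lt with rfl | hjn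
    · exact hXn
    have h1 : 0 < t j := ht0 ▸ hsm j hj 0 hj0
    have h2 : t j < 2 * Real.pi := htn ▸ hsm n le_rfl j hjn
    rcases lt_trichotomy (t j) Real.pi with h3 | h3 | h3
    · exact absurd hs (Real.sin_pos_of_pos_of_lt_pi h1 h3).ne'
    -- A node exactly at π must be the left end of the exceptional arc, and `hk3` then forces its
    -- value to be 0.
    · have hjk : j = k := by
        rcases lt_trichotomy j k with h | h | h
        · linarith [hsm k hk.le j h]
        · exact h
        · linarith [hmono j hj (k + 1) h]
      subst hjk
      rw [hs, mul_zero] at hk3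
      refine (mul_eq_zero.1 hk3).resolve_right ?_
      have : Real.sin (t (j + 1) - Real.pi) ≠ 0 :=
        (Real.sin_pos_of_pos_of_lt_pi (by linarith) (by linarith [hpi j hk])).ne'
      rw [Real.sin_sub_pi] at this
      exact fun h => this (by rw [h, neg_zero])
    · have := Real.sin_pos_of_pos_of_lt_pi (x := t j - Real.pi) (by linarith) (by linarith)
      rw [Real.sin_sub_pi, hs] at this
      simp at this
  have hterm : ∀ j ∈ Finset.range n,
      X (j + 1) ^ 2 * (Real.cos (t (j + 1)) / Real.sin (t (j + 1))) -
        X j ^ 2 * (Real.cos (t j) / Real.sin (t j)) ≤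
      arcEnergy (t (j + 1) - t j) (X j) (X (j + 1)) := by
    intro j hj
    rw [Finset.mem_range] at hj
    have e : t j + (t (j + 1) - t j) = t (j + 1) := by ring
    have := arcEnergy_ge_of_sin_mul_sin (t j) (t (j + 1) - t j) (X j) (X (j + 1))
      (Real.sin_pos_of_pos_of_lt_pi (by linarith [hlt j hj]) (by linarith [hpi j hj]))
      (hzero j hj.le) (by rw [e]; exact hzero (j + 1) hj)
    rw [e] at this
    refine this ?_
    rcases lt_trichotomy j k with h | h | h
    · left
      have h1 : 0 ≤ t j := ht0 ▸ hmono j hj.le 0 (Nat.zero_le _)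
      have h2 := hlt j hj
      have h3 := hmono k hk.le (j + 1) h
      exact mul_nonneg (Real.sin_nonneg_of_nonneg_of_le_pi h1 (by linarith))
        (Real.sin_nonneg_of_nonneg_of_le_pi (by linarith) (by linarith))
    · right
      subst h
      exact hk3
    · left
      have h1 := hmono j hj.le (k + 1) h
      have h2 := hlt j hj
      have h3 := hmono n le_rfl (j + 1) hj
      have h4 := Real.sin_nonneg_of_nonneg_of_le_pi (x := t j - Real.pi) (by linarith) (by linarith)
      have h5 := Real.sin_nonneg_of_nonneg_of_le_pi (x := t (j + 1) - Real.pi) (by linarith)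
        (by linarith)
      rw [Real.sin_sub_pi] at h4 h5
      nlinarith
  refine le_trans ?_ (Finset.sum_le_sum hterm)
  rw [Finset.sum_range_sub (fun j => X j ^ 2 * (Real.cos (t j) / Real.sin (t j))), hX0, hXn]
  simp

theorem exists_lt_le_lt_succ {n : ℕ} (t : ℕ → ℝ) {c : ℝ} (h0 : t 0 ≤ c) (hn : c < t n) :
    ∃ k < n, t k ≤ c ∧ c < t (k + 1) := by
  by_contra! h
  have : ∀ j ≤ n, t j ≤ c := by
    intro j
    induction j with
    | zero => exact fun _ => h0
    | succ m ih => exact fun hm => h m hm (ih (by omega))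
  exact absurd (this n le_rfl) (not_le.2 hn)

theorem one_sub_cos_div_sin (x : ℝ) :
    (1 - Real.cos x) / Real.sin x = Real.tan (x / 2) := by
  obtain ⟨y, rfl⟩ : ∃ y, x = 2 * y := ⟨x / 2, by ring⟩
  have h1 : 1 - Real.cos (2 * y) = 2 * Real.sin y * Real.sin y := by
    rw [Real.cos_two_mul, Real.cos_sq']
    ring
  rw [h1, Real.sin_two_mul, mul_div_cancel_left₀ y two_ne_zero, Real.tan_eq_sin_div_cos]
  by_cases hs : Real.sin y = 0
  · simp [hs]
  · rw [mul_div_mul_left _ _ (by simpa using hs)]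

/-- Since cos solves h'' = -h, subtracting a multiple of it alters the energy by boundary terms
only; these carry a factor sin and so vanish at 0 and 2π. Subtracting the constant c contributes the
mean and a term in c². -/
theorem arcEnergy_sub_const_sub_cos (t t' p q c a : ℝ) (hs : Real.sin (t' - t) ≠ 0) :
    arcEnergy (t' - t) (p - c - a * Real.cos t) (q - c - a * Real.cos t') =
      arcEnergy (t' - t) p q + 2 * c * ((p + q) * Real.tan ((t' - t) / 2)) -
        2 * c ^ 2 * Real.tan ((t' - t) / 2) +
        (a * (2 * (q - c) - a * Real.cos t') * Real.sin t' -
          a * (2 * (p - c) - a * Real.cos t) * Real.sin t) := by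
  obtain ⟨δ, rfl⟩ : ∃ δ, t' = t + δ := ⟨t' - t, by ring⟩
  rw [add_sub_cancel_left] at *
  have hsq := Real.sin_sq_add_cos_sq δ
  have hT := one_sub_cos_div_sin δ
  rw [div_eq_iff hs] at hT
  have hE : arcEnergy δ p q * Real.sin δ = (p ^ 2 + q ^ 2) * Real.cos δ - 2 * p * q :=
    div_mul_cancel₀ _ hs
  rw [arcEnergy, div_eq_iff hs, Real.cos_add, Real.sin_add]
  linear_combination -hE + (2 * c * (p + q) - 2 * c ^ 2) * hT +
    (-2 * a * (q - c) * Real.cos t + a ^ 2 * Real.cos t *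
      (Real.cos t * Real.cos δ - Real.sin t * Real.sin δ)) * hsq

/-- **Discrete Wirtinger inequality** on the circle of length `2 * π`. -/
theorem sum_arcEnergy_nonneg {n : ℕ} (t X : ℕ → ℝ) (ht0 : t 0 = 0)
    (htn : t n = 2 * Real.pi) (hlt : ∀ j < n, t j < t (j + 1))
    (hpi : ∀ j < n, t (j + 1) < t j + Real.pi) (hX : X n = X 0)
    (hmean : ∑ j ∈ Finset.range n, (X j + X (j + 1)) * Real.tan ((t (j + 1) - t j) / 2) = 0) :
    0 ≤ ∑ j ∈ Finset.range n, arcEnergy (t (j + 1) - t j) (X j) (X (j + 1)) := by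
  have hpos := Real.pi_pos
  obtain ⟨k, hk, hk1, hk2⟩ := exists_lt_le_lt_succ (n := n) t (c := Real.pi) (by linarith)
    (by linarith)
  have hsin : ∀ j < n, 0 < Real.sin (t (j + 1) - t j) := fun j hj =>
    Real.sin_pos_of_pos_of_lt_pi (by linarith [hlt j hj]) (by linarith [hpi j hj])
  have htan : ∀ j < n, 0 < Real.tan ((t (j + 1) - t j) / 2) := fun j hj =>
    Real.tan_pos_of_pos_of_lt_pi_div_two (by linarith [hlt j hj]) (by linarith [hpi j hj])
  have hd := hsin k hk
  set d := Real.sin (t (k + 1) - t k) with hd_def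
  have hu : 0 ≤ Real.sin (t (k + 1) - Real.pi) := Real.sin_nonneg_of_nonneg_of_le_pi
    (by linarith) (by linarith [hpi k hk])
  have hkk : 0 ≤ t k := by
    have : ∀ j ≤ n, 0 ≤ t j := by
      intro j
      induction j with
      | zero => exact fun _ => ht0.ge
      | succ m ih => exact fun hm => (ih (by omega)).trans (hlt m hm).le
    exact this k hk.le
  have hv : 0 ≤ Real.sin (t k) := Real.sin_nonneg_of_nonneg_of_le_pi hkk hk1
  set u := Real.sin (t (k + 1) - Real.pi) with hu_def
  set v := Real.sin (t k) with hv_def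
  -- Subtracting c + (X 0 - c) cos already gives zero at 0 and 2π. This c is the weighted mean that
  -- makes the interpolant on the k-th arc vanish at π as well.
  obtain ⟨c, hc⟩ : ∃ c, X 0 * d + X k * u + X (k + 1) * v = c * (d + u + v) :=
    ⟨_, (div_mul_cancel₀ _ (by positivity)).symm⟩
  let Z : ℕ → ℝ := fun j => X j - c - (X 0 - c) * Real.cos (t j)
  have hZ := sum_arcEnergy_nonneg_of_interpolant_eq_zero t Z ht0 htn hlt hpi
    (by simp [Z, ht0]) (by simp [Z, htn, hX]) hk hk1 hk2 (by
      have e1 : Real.sin (t (k + 1)) = -u := by rw [hu_def, Real.sin_sub_pi, neg_neg]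
      have e2 : d = Real.sin (t (k + 1)) * Real.cos (t k) - Real.cos (t (k + 1)) * v := by
        rw [hd_def, Real.sin_sub]
      rw [e1] at e2 ⊢
      rw [← hv_def]
      simp only [Z]
      linear_combination (-1 : ℝ) * hc + (X 0 - c) * e2)
  have hterm : ∀ j ∈ Finset.range n, arcEnergy (t (j + 1) - t j) (Z j) (Z (j + 1)) =
      arcEnergy (t (j + 1) - t j) (X j) (X (j + 1)) +
        2 * c * ((X j + X (j + 1)) * Real.tan ((t (j + 1) - t j) / 2)) -
        2 * c ^ 2 * Real.tan ((t (j + 1) - t j) / 2) +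
        ((X 0 - c) * (2 * (X (j + 1) - c) - (X 0 - c) * Real.cos (t (j + 1))) *
            Real.sin (t (j + 1)) -
          (X 0 - c) * (2 * (X j - c) - (X 0 - c) * Real.cos (t j)) * Real.sin (t j)) := by
    intro j hj
    exact arcEnergy_sub_const_sub_cos _ _ _ _ _ _ (hsin j (Finset.mem_range.1 hj)).ne'
  -- The mean and the boundary terms drop out, leaving an energy of at least 2c² times the sum of
  -- the half-angle tangents.
  rw [Finset.sum_congr rfl hterm, Finset.sum_add_distrib, Finset.sum_sub_distrib,
    Finset.sum_add_distrib, ← Finset.mul_sum, ← Finset.mul_sum, hmean,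
    Finset.sum_range_sub (fun j => (X 0 - c) * (2 * (X j - c) - (X 0 - c) * Real.cos (t j)) *
      Real.sin (t j)), ht0, htn] at hZ
  have h2 : 0 ≤ ∑ j ∈ Finset.range n, Real.tan ((t (j + 1) - t j) / 2) :=
    Finset.sum_nonneg fun j hj => (htan j (Finset.mem_range.1 hj)).le
  have h3 : 0 ≤ c ^ 2 * ∑ j ∈ Finset.range n, Real.tan ((t (j + 1) - t j) / 2) := by positivity
  simp at hZ
  linarith

/-! ### Cyclic bookkeeping of the normal directions -/

section RayAngle

theorem rayAngle_of_succ_eq {n : ℕ} (α : Fin n → ℝ) {i : Fin n} (h : i.val + 1 = n) :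
    rayAngle α i = totalAngle α := by
  have : Finset.Iic i = Finset.univ := by
    ext j
    simp only [Finset.mem_Iic, Finset.mem_univ, iff_true, Fin.le_def]
    omega
  rw [rayAngle, this, totalAngle]

variable {n : ℕ} [NeZero n]

theorem Fin.val_add_one_of_succ_lt {i : Fin n} (h : i.val + 1 < n) : (i + 1).val = i.val + 1 := by
  have h1 : 1 < n := by omega
  rw [Fin.val_add, Fin.val_one', Nat.mod_eq_of_lt h1, Nat.mod_eq_of_lt h]

theorem Fin.add_one_eq_zero_of_succ_eq {i : Fin n} (h : i.val + 1 = n) : i + 1 = 0 := by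
  apply Fin.ext
  rw [Fin.val_add, Fin.val_one', Nat.add_mod_mod, h, Nat.mod_self, Fin.val_zero]

theorem rayAngle_zero (α : Fin n → ℝ) : rayAngle α 0 = α 0 := by
  have : Finset.Iic (0 : Fin n) = {0} := by
    ext j
    simp
  rw [rayAngle, this, Finset.sum_singleton]

theorem rayAngle_add_one_of_lt (α : Fin n → ℝ) {i : Fin n} (h : i.val + 1 < n) :
    rayAngle α (i + 1) = rayAngle α i + α (i + 1) := by
  have h1 := Fin.val_add_one_of_succ_lt h
  have : Finset.Iic (i + 1) = insert (i + 1) (Finset.Iic i) := by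
    ext j
    simp only [Finset.mem_Iic, Finset.mem_insert, Fin.le_def, Fin.ext_iff, h1]
    omega
  rw [rayAngle, this, Finset.sum_insert (by simp [Fin.le_def, h1]), rayAngle, add_comm]

theorem rayAngle_add_one_of_eq (α : Fin n → ℝ) {i : Fin n} (h : i.val + 1 = n) :
    rayAngle α (i + 1) = rayAngle α i + α (i + 1) - totalAngle α := by
  rw [rayAngle_of_succ_eq α h, Fin.add_one_eq_zero_of_succ_eq h, rayAngle_zero]
  ring

theorem exp_rayAngle_add_one (α : Fin n → ℝ) (hω : totalAngle α = 2 * Real.pi) (i : Fin n) :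
    Complex.exp (rayAngle α (i + 1) * Complex.I) =
      Complex.exp (rayAngle α i * Complex.I) * Complex.exp (α (i + 1) * Complex.I) := by
  rcases (Nat.succ_le_of_lt i.isLt).lt_or_eq with h | h
  · rw [rayAngle_add_one_of_lt α h, ← Complex.exp_add]
    push_cast
    ring_nf
  · rw [rayAngle_add_one_of_eq α h, hω, ← Complex.exp_add]
    rw [Complex.exp_eq_exp_iff_exists_int]
    exact ⟨-1, by push_cast; ring⟩

end RayAngle

/-! ### Signed lengths and the area form -/

section Forms

variable {n : ℕ} [NeZero n]

theorem endPoint_eq_exp_mul_startPoint (α x : Fin n → ℝ) (hα : ∀ i, α i ∈ Set.Ioo 0 Real.pi)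
    (i : Fin n) :
    endPoint α x i = Complex.exp (α (i + 1) * Complex.I) * startPoint α x (i + 1) := by
  have hs := (Real.sin_pos_of_mem_Ioo (hα (i + 1))).ne'
  have hsq := Real.sin_sq_add_cos_sq (α (i + 1))
  apply Complex.ext
  · simp only [endPoint, startPoint, Complex.mul_re, Complex.exp_ofReal_mul_I_re,
      Complex.exp_ofReal_mul_I_im, add_sub_cancel_right]
    field_simp
    ring
  · simp only [endPoint, startPoint, Complex.mul_im, Complex.exp_ofReal_mul_I_re,
      Complex.exp_ofReal_mul_I_im, add_sub_cancel_right]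
    field_simp
    linear_combination -x (i + 1) * hsq

theorem signedLength_eq (α x : Fin n → ℝ) (i : Fin n) : signedLength α x i =
    (x (i + 1) - x i * Real.cos (α (i + 1))) / Real.sin (α (i + 1)) -
      (x i * Real.cos (α i) - x (i - 1)) / Real.sin (α i) := by
  simp [signedLength, startPoint, endPoint]

theorem startPoint_add (α x y : Fin n → ℝ) (i : Fin n) :
    startPoint α (x + y) i = startPoint α x i + startPoint α y i := by
  apply Complex.ext <;> simp [startPoint]
  ring

theorem endPoint_add (α x y : Fin n → ℝ) (i : Fin n) :
    endPoint α (x + y) i = endPoint α x i + endPoint α y i := by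
  apply Complex.ext <;> simp [endPoint]
  ring

theorem signedLength_add (α x y : Fin n → ℝ) (i : Fin n) :
    signedLength α (x + y) i = signedLength α x i + signedLength α y i := by
  simp only [signedLength, startPoint_add, endPoint_add, Complex.sub_im, Complex.add_im]
  ring

theorem signedLength_smul (α x : Fin n → ℝ) (c : ℝ) (i : Fin n) :
    signedLength α (c • x) i = c * signedLength α x i := by
  simp only [signedLength_eq, Pi.smul_apply, smul_eq_mul]
  ring

/-- The symmetric bilinear form whose quadratic form is twice the area. -/
def pairing (α x y : Fin n → ℝ) : ℝ := ∑ i, x i * signedLength α y i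

theorem sum_add_one_eq (f : Fin n → ℝ) : ∑ i, f (i + 1) = ∑ i, f i :=
  Equiv.sum_comp (Equiv.addRight (1 : Fin n)) f

/-- Cyclic summation by parts regroups the sum over sides into a sum over the angular regions, where
the symmetry is visible. -/
theorem pairing_eq (α x y : Fin n → ℝ) : pairing α x y =
    ∑ i, (x i * y (i - 1) + x (i - 1) * y i -
      (x i * y i + x (i - 1) * y (i - 1)) * Real.cos (α i)) / Real.sin (α i) := by
  have h := sum_add_one_eq fun i =>
    x (i - 1) * ((y i - y (i - 1) * Real.cos (α i)) / Real.sin (α i))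
  simp only [add_sub_cancel_right] at h
  simp only [pairing, signedLength_eq, mul_sub, Finset.sum_sub_distrib]
  rw [h, ← Finset.sum_sub_distrib]
  exact Finset.sum_congr rfl fun i _ => by ring

theorem pairing_comm (α x y : Fin n → ℝ) : pairing α x y = pairing α y x := by
  rw [pairing_eq, pairing_eq]
  exact Finset.sum_congr rfl fun i _ => by ring

theorem pairing_add_right (α x y z : Fin n → ℝ) :
    pairing α x (y + z) = pairing α x y + pairing α x z := by
  simp only [pairing, signedLength_add, mul_add, Finset.sum_add_distrib]

theorem pairing_smul_right (α x y : Fin n → ℝ) (c : ℝ) :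
    pairing α x (c • y) = c * pairing α x y := by
  simp only [pairing, signedLength_smul, Finset.mul_sum]
  exact Finset.sum_congr rfl fun i _ => by ring

theorem pairing_one_left (α y : Fin n → ℝ) : pairing α 1 y = ∑ i, signedLength α y i := by
  simp [pairing]

theorem pairing_add_self (α x y : Fin n → ℝ) :
    pairing α (x + y) (x + y) = pairing α x x + 2 * pairing α x y + pairing α y y := by
  rw [pairing_add_right, pairing_comm α _ x, pairing_comm α _ y, pairing_add_right,
    pairing_add_right, pairing_comm α y x]
  ring

theorem pairing_self_eq (α x : Fin n → ℝ) :
    pairing α x x = -∑ i, arcEnergy (α i) (x (i - 1)) (x i) := by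
  rw [pairing_eq, ← Finset.sum_neg_distrib]
  refine Finset.sum_congr rfl fun i _ => ?_
  rw [arcEnergy]
  ring

/-- This form is linear in the half-angle tangents, so its vanishing survives a common rescaling of
them. -/
theorem sum_signedLength_eq (α x : Fin n → ℝ) :
    ∑ i, signedLength α x i = ∑ i, (x (i - 1) + x i) * Real.tan (α i / 2) := by
  rw [← pairing_one_left, pairing_eq]
  refine Finset.sum_congr rfl fun i _ => ?_
  rw [← one_sub_cos_div_sin, Pi.one_apply, Pi.one_apply]
  ring

theorem signedLength_one (α : Fin n → ℝ) (i : Fin n) :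
    signedLength α 1 i = Real.tan (α i / 2) + Real.tan (α (i + 1) / 2) := by
  rw [signedLength_eq, ← one_sub_cos_div_sin, ← one_sub_cos_div_sin, Pi.one_apply, Pi.one_apply,
    Pi.one_apply]
  ring

theorem tan_half_pos {δ : ℝ} (hδ : δ ∈ Set.Ioo 0 Real.pi) : 0 < Real.tan (δ / 2) :=
  Real.tan_pos_of_pos_of_lt_pi_div_two (by linarith [hδ.1]) (by linarith [hδ.2])

theorem signedLength_one_pos (α : Fin n → ℝ) (hα : ∀ i, α i ∈ Set.Ioo 0 Real.pi) (i : Fin n) :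
    0 < signedLength α 1 i := by
  rw [signedLength_one]
  exact add_pos (tan_half_pos (hα i)) (tan_half_pos (hα (i + 1)))

theorem pairing_one_one_pos (α : Fin n → ℝ) (hα : ∀ i, α i ∈ Set.Ioo 0 Real.pi) :
    0 < pairing α 1 1 := by
  rw [pairing_one_left]
  exact Finset.sum_pos (fun i _ => signedLength_one_pos α hα i) Finset.univ_nonempty

/-- If all lines pass through the point `u` of the plane, then so do their intersections. -/
theorem startPoint_of_point (α y : Fin n → ℝ) (hα : ∀ i, α i ∈ Set.Ioo 0 Real.pi)
    (hω : totalAngle α = 2 * Real.pi) (u : ℂ)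
    (hy : ∀ i, y i = (u * Complex.exp (-(rayAngle α i * Complex.I))).re) (i : Fin n) :
    startPoint α y i = u * Complex.exp (-(rayAngle α i * Complex.I)) := by
  have hs := (Real.sin_pos_of_mem_Ioo (hα i)).ne'
  apply Complex.ext
  · rw [← hy i]
    rfl
  · have h1 := exp_rayAngle_add_one α hω (i - 1)
    rw [sub_add_cancel] at h1
    have h2 : u * Complex.exp (-(rayAngle α (i - 1) * Complex.I)) =
        u * Complex.exp (-(rayAngle α i * Complex.I)) * Complex.exp (α i * Complex.I) := by
      rw [Complex.exp_neg, Complex.exp_neg, h1]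
      field_simp
    simp only [startPoint, hy i, hy (i - 1), h2]
    rw [Complex.mul_re _ (Complex.exp (α i * Complex.I)), Complex.exp_ofReal_mul_I_re,
      Complex.exp_ofReal_mul_I_im]
    field_simp
    ring

theorem endPoint_of_point (α y : Fin n → ℝ) (hα : ∀ i, α i ∈ Set.Ioo 0 Real.pi)
    (hω : totalAngle α = 2 * Real.pi) (u : ℂ)
    (hy : ∀ i, y i = (u * Complex.exp (-(rayAngle α i * Complex.I))).re) (i : Fin n) :
    endPoint α y i = u * Complex.exp (-(rayAngle α i * Complex.I)) := by
  rw [endPoint_eq_exp_mul_startPoint α y hα, startPoint_of_point α y hα hω u hy,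
    Complex.exp_neg, Complex.exp_neg, exp_rayAngle_add_one α hω]
  field_simp

theorem signedLength_of_point (α y : Fin n → ℝ) (hα : ∀ i, α i ∈ Set.Ioo 0 Real.pi)
    (hω : totalAngle α = 2 * Real.pi) (u : ℂ)
    (hy : ∀ i, y i = (u * Complex.exp (-(rayAngle α i * Complex.I))).re) (i : Fin n) :
    signedLength α y i = 0 := by
  rw [signedLength, startPoint_of_point α y hα hω u hy, endPoint_of_point α y hα hω u hy,
    sub_self, Complex.zero_im]

theorem endPoint_eq_startPoint (α y : Fin n → ℝ) {i : Fin n} (h : signedLength α y i = 0) :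
    endPoint α y i = startPoint α y i :=
  Complex.ext rfl (sub_eq_zero.1 h)

/-- A side of length zero is a single vertex, so after rotation by the ray angles all vertices
coincide at one v. One turn around the cone multiplies v by exp(iω), which differs from 1 when 0 < ω
< 2π. -/
theorem exists_point_of_signedLength_eq_zero (α y : Fin n → ℝ)
    (hα : ∀ i, α i ∈ Set.Ioo 0 Real.pi) (h : ∀ i, signedLength α y i = 0) :
    ∃ v : ℂ, (∀ i, startPoint α y i = v * Complex.exp (-(rayAngle α i * Complex.I))) ∧
      (totalAngle α < 2 * Real.pi → v = 0) := by
  have hstep : ∀ i, startPoint α y i =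
      Complex.exp (α (i + 1) * Complex.I) * startPoint α y (i + 1) := fun i => by
    rw [← endPoint_eq_exp_mul_startPoint α y hα, endPoint_eq_startPoint α y (h i)]
  set w : Fin n → ℂ := fun i => startPoint α y i * Complex.exp (rayAngle α i * Complex.I) with hw
  have hw1 : ∀ i : Fin n, i.val + 1 < n → w (i + 1) = w i := by
    intro i hi
    simp only [hw]
    rw [rayAngle_add_one_of_lt α hi, hstep i]
    push_cast
    rw [add_mul, Complex.exp_add]
    ring
  have hconst : ∀ k (hk : k < n), w ⟨k, hk⟩ = w 0 := by
    intro k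
    induction k with
    | zero => exact fun _ => rfl
    | succ k ih =>
      intro hk
      rw [← ih (by omega), ← hw1 ⟨k, by omega⟩ hk]
      congr 1
      exact Fin.ext (Fin.val_add_one_of_succ_lt (i := ⟨k, by omega⟩) hk).symm
  refine ⟨w 0, fun i => ?_, fun hω => ?_⟩
  · rw [← hconst i.1 i.2]
    simp only [hw]
    rw [mul_assoc, ← Complex.exp_add, add_neg_cancel, Complex.exp_zero, mul_one]
  · have hn : n - 1 + 1 = n := Nat.sub_add_cancel (NeZero.one_le)
    have hlast : w (⟨n - 1, by omega⟩ + 1) * Complex.exp (totalAngle α * Complex.I) =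
        w ⟨n - 1, by omega⟩ := by
      simp only [hw]
      rw [rayAngle_add_one_of_eq α (i := ⟨n - 1, by omega⟩) hn, hstep ⟨n - 1, by omega⟩]
      push_cast
      rw [sub_mul, add_mul, Complex.exp_sub, Complex.exp_add]
      field_simp
    rw [Fin.add_one_eq_zero_of_succ_eq (i := ⟨n - 1, by omega⟩) hn, hconst (n - 1)] at hlast
    by_contra h0
    have h1 : Complex.exp (totalAngle α * Complex.I) = 1 :=
      mul_left_cancel₀ h0 (by rw [hlast, mul_one])
    have h2 := congrArg Complex.re h1
    rw [Complex.exp_ofReal_mul_I_re, Complex.one_re] at h2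
    have h3 : 0 < totalAngle α :=
      Finset.sum_pos (fun i _ => (hα i).1) Finset.univ_nonempty
    exact h3.ne' ((Real.cos_eq_one_iff_of_lt_of_lt (by linarith) hω).1 h2)

end Forms

/-! ### Comparison with total angle 2π and sign of the area form -/

section Comparison

theorem arcEnergy_eq_tan {δ : ℝ} (hδ : δ ∈ Set.Ioo 0 Real.pi) (p q : ℝ) :
    arcEnergy δ p q = -(p ^ 2 + q ^ 2) * Real.tan (δ / 2) +
      (p - q) ^ 2 * (1 + Real.tan (δ / 2) ^ 2) / (2 * Real.tan (δ / 2)) := by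
  obtain ⟨y, rfl⟩ : ∃ y, δ = 2 * y := ⟨δ / 2, by ring⟩
  rw [mul_div_cancel_left₀ y two_ne_zero]
  have hs : Real.sin y ≠ 0 :=
    (Real.sin_pos_of_pos_of_lt_pi (by linarith [hδ.1]) (by linarith [hδ.1, hδ.2])).ne'
  have hc : Real.cos y ≠ 0 :=
    (Real.cos_pos_of_mem_Ioo ⟨by linarith [hδ.1, Real.pi_pos], by linarith [hδ.2]⟩).ne'
  have hsq := Real.sin_sq_add_cos_sq y
  rw [arcEnergy, Real.cos_two_mul, Real.sin_two_mul, Real.tan_eq_sin_div_cos]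
  field_simp
  linear_combination ((p ^ 2 + q ^ 2) * 2 - (p - q) ^ 2) * hsq

/-- The angle whose half has the `s`-fold tangent. -/
def scaledAngle (s δ : ℝ) : ℝ := 2 * Real.arctan (s * Real.tan (δ / 2))

theorem scaledAngle_mem {s δ : ℝ} (hs : 0 < s) (hδ : δ ∈ Set.Ioo 0 Real.pi) :
    scaledAngle s δ ∈ Set.Ioo 0 Real.pi := by
  have h1 := Real.arctan_pos.2 (mul_pos hs (tan_half_pos hδ))
  have h2 := Real.arctan_lt_pi_div_two (s * Real.tan (δ / 2))
  constructor <;> unfold scaledAngle <;> linarith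

theorem tan_half_scaledAngle (s δ : ℝ) :
    Real.tan (scaledAngle s δ / 2) = s * Real.tan (δ / 2) := by
  rw [scaledAngle, mul_div_cancel_left₀ _ two_ne_zero, Real.tan_arctan]

/-- In terms of T = tan(δ/2) the energy is -(p² + q²)T + (p - q)²(1/T + T)/2. Only the 1/T part
fails to scale like T, and it leaves a remainder with the sign of s - 1. -/
theorem arcEnergy_eq_scaledAngle {s δ : ℝ} (hs : 0 < s) (hδ : δ ∈ Set.Ioo 0 Real.pi) (p q : ℝ) :
    arcEnergy δ p q = arcEnergy (scaledAngle s δ) p q / s +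
      (1 - 1 / s ^ 2) * ((p - q) ^ 2 / (2 * Real.tan (δ / 2))) := by
  have hT := (tan_half_pos hδ).ne'
  rw [arcEnergy_eq_tan hδ, arcEnergy_eq_tan (scaledAngle_mem hs hδ), tan_half_scaledAngle]
  field_simp
  ring

theorem scaledAngle_one {δ : ℝ} (hδ : δ ∈ Set.Ioo 0 Real.pi) : scaledAngle 1 δ = δ := by
  rw [scaledAngle, one_mul, Real.arctan_tan (by linarith [hδ.1, Real.pi_pos]) (by linarith [hδ.2])]
  ring

theorem scaledAngle_le_of_le {s s' δ : ℝ} (h : s ≤ s') (hδ : δ ∈ Set.Ioo 0 Real.pi) :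
    scaledAngle s δ ≤ scaledAngle s' δ := by
  have := Real.arctan_strictMono.monotone
    (mul_le_mul_of_nonneg_right h (tan_half_pos hδ).le)
  unfold scaledAngle
  linarith

theorem scaledAngle_lt_of_lt {s s' δ : ℝ} (h : s < s') (hδ : δ ∈ Set.Ioo 0 Real.pi) :
    scaledAngle s δ < scaledAngle s' δ := by
  have := Real.arctan_strictMono (mul_lt_mul_of_pos_right h (tan_half_pos hδ))
  unfold scaledAngle
  linarith

/-- The sum of the angles increases from 0 to the limit nπ, which exceeds 2π exactly when n > 2. -/
theorem exists_sum_scaledAngle_eq {n : ℕ} (α : Fin n → ℝ) (hα : ∀ i, α i ∈ Set.Ioo 0 Real.pi)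
    (hn : 2 < n) : ∃ s > 0, ∑ i, scaledAngle s (α i) = 2 * Real.pi := by
  have hcont : Continuous fun s => ∑ i, scaledAngle s (α i) := by
    unfold scaledAngle
    fun_prop
  have hlim : Filter.Tendsto (fun s => ∑ i, scaledAngle s (α i)) Filter.atTop
      (nhds (∑ _i : Fin n, 2 * (Real.pi / 2))) := by
    refine tendsto_finsetSum _ fun i _ => ?_
    refine Filter.Tendsto.const_mul _ ?_
    refine (tendsto_nhds_of_tendsto_nhdsWithin Real.tendsto_arctan_atTop).comp ?_
    exact Filter.tendsto_id.atTop_mul_const (tan_half_pos (hα i))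
  have hlt : 2 * Real.pi < ∑ _i : Fin n, 2 * (Real.pi / 2) := by
    have : (2 : ℝ) < n := by exact_mod_cast hn
    simp only [Finset.sum_const, Finset.card_univ, Fintype.card_fin, nsmul_eq_mul]
    nlinarith [Real.pi_pos]
  obtain ⟨S, hS⟩ := (hlim.eventually (lt_mem_nhds hlt)).exists
  have h0 : ∑ i, scaledAngle 0 (α i) = 0 := by simp [scaledAngle]
  obtain ⟨s, hs⟩ := mem_range_of_exists_le_of_exists_ge hcont
    ⟨0, by rw [h0]; positivity⟩ ⟨S, hS.le⟩
  refine ⟨s, ?_, hs⟩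
  by_contra! hneg
  have : ∑ i, scaledAngle s (α i) ≤ ∑ i, scaledAngle 0 (α i) :=
    Finset.sum_le_sum fun i _ => scaledAngle_le_of_le hneg (hα i)
  simp only at hs
  linarith [Real.pi_pos]

variable {n : ℕ} [NeZero n]

theorem Fin.ofNat_succ_eq (j : ℕ) : Fin.ofNat n (j + 1) = Fin.ofNat n j + 1 := by
  apply Fin.ext
  simp [Fin.val_add, Fin.ofNat]

theorem sum_arcEnergy_nonneg_of_sum_eq_two_pi (γ y : Fin n → ℝ)
    (hγ : ∀ i, γ i ∈ Set.Ioo 0 Real.pi) (hsum : ∑ i, γ i = 2 * Real.pi)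
    (hmean : ∑ i, (y (i - 1) + y i) * Real.tan (γ i / 2) = 0) :
    0 ≤ ∑ i, arcEnergy (γ i) (y (i - 1)) (y i) := by
  have hval : ∀ i : Fin n, Fin.ofNat n i.val = i := fun i => by simp
  have hconv : ∀ f : Fin n → ℝ, ∑ j ∈ Finset.range n, f (Fin.ofNat n j) = ∑ i, f i := fun f => by
    rw [Finset.sum_range]
    simp only [hval]
  have hsucc : ∀ j, Fin.ofNat n (j + 1) - 1 = Fin.ofNat n j := fun j => by
    rw [Fin.ofNat_succ_eq, add_sub_cancel_right]
  have hn : Fin.ofNat n n = Fin.ofNat n 0 := by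
    apply Fin.ext
    simp [Fin.ofNat]
  have ht : ∀ j, (∑ i ∈ Finset.range (j + 1), γ (Fin.ofNat n i)) -
      ∑ i ∈ Finset.range j, γ (Fin.ofNat n i) = γ (Fin.ofNat n j) := fun j => by
    rw [Finset.sum_range_succ, add_sub_cancel_left]
  -- The index shift makes the arc of length γ j run from y (j - 1) to y j.
  have := sum_arcEnergy_nonneg (n := n) (fun j => ∑ i ∈ Finset.range j, γ (Fin.ofNat n i))
    (fun j => y (Fin.ofNat n j - 1)) (by simp) ((hconv γ).trans hsum)
    (fun j _ => by
      have := (hγ (Fin.ofNat n j)).1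
      simp only [Finset.sum_range_succ]
      linarith)
    (fun j _ => by
      have := (hγ (Fin.ofNat n j)).2
      simp only [Finset.sum_range_succ]
      linarith)
    (by simp only [hn])
    (by
      simp only [ht, hsucc]
      exact (hconv fun i => (y (i - 1) + y i) * Real.tan (γ i / 2)).trans hmean)
  simp only [ht, hsucc] at this
  rwa [hconv fun i => arcEnergy (γ i) (y (i - 1)) (y i)] at this

theorem sum_arcEnergy_nonneg_of_le_two (α y : Fin n → ℝ)
    (hα : ∀ i, α i ∈ Set.Ioo 0 Real.pi) (hn : n ≤ 2)
    (hmean : ∑ i, (y (i - 1) + y i) * Real.tan (α i / 2) = 0) :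
    0 ≤ ∑ i, arcEnergy (α i) (y (i - 1)) (y i) := by
  -- For at most two indices all the sums y (i - 1) + y i agree, so the mean condition forces them
  -- to be 0 and each energy is an explicit square.
  obtain ⟨c, hc⟩ : ∃ c, ∀ i, y (i - 1) + y i = c := by
    have h0 : n ≠ 0 := NeZero.ne n
    obtain rfl | rfl : n = 1 ∨ n = 2 := by omega
    · refine ⟨y 0 + y 0, fun i => ?_⟩
      rw [Subsingleton.elim (i - 1) 0, Subsingleton.elim i 0]
    · refine ⟨y 0 + y 1, fun i => ?_⟩
      fin_cases i
      · exact add_comm _ _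
      · rfl
  have hT : 0 < ∑ i, Real.tan (α i / 2) :=
    Finset.sum_pos (fun i _ => tan_half_pos (hα i)) Finset.univ_nonempty
  simp only [hc, ← Finset.mul_sum] at hmean
  have hc0 : c = 0 := (mul_eq_zero.1 hmean).resolve_right hT.ne'
  refine Finset.sum_nonneg fun i _ => ?_
  have h1 := tan_half_pos (hα i)
  have h2 : y (i - 1) = -y i := by linarith [hc i]
  rw [arcEnergy_eq_tan (hα i), h2]
  have : -((-y i) ^ 2 + y i ^ 2) * Real.tan (α i / 2) +
      (-y i - y i) ^ 2 * (1 + Real.tan (α i / 2) ^ 2) / (2 * Real.tan (α i / 2)) =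
      2 * y i ^ 2 / Real.tan (α i / 2) := by
    field_simp
    ring
  rw [this]
  positivity

theorem pairing_self_nonpos (α y : Fin n → ℝ) (hα : ∀ i, α i ∈ Set.Ioo 0 Real.pi)
    (hω : totalAngle α ≤ 2 * Real.pi) (hy : pairing α 1 y = 0) : pairing α y y ≤ 0 := by
  rw [pairing_one_left, sum_signedLength_eq] at hy
  rw [pairing_self_eq, neg_nonpos]
  rcases le_or_gt n 2 with hn | hn
  · exact sum_arcEnergy_nonneg_of_le_two α y hα hn hy
  obtain ⟨s, hs, hsum⟩ := exists_sum_scaledAngle_eq α hα hn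
  have hs1 : 1 ≤ s := by
    by_contra! h
    have : ∑ i, scaledAngle s (α i) < ∑ i, scaledAngle 1 (α i) :=
      Finset.sum_lt_sum_of_nonempty Finset.univ_nonempty fun i _ => scaledAngle_lt_of_lt h (hα i)
    simp only [scaledAngle_one (hα _)] at this
    unfold totalAngle at hω
    linarith
  have h1 := sum_arcEnergy_nonneg_of_sum_eq_two_pi (fun i => scaledAngle s (α i)) y
    (fun i => scaledAngle_mem hs (hα i)) hsum (by
      simp only [tan_half_scaledAngle, mul_left_comm _ s, ← Finset.mul_sum, hy, mul_zero])
  simp only [arcEnergy_eq_scaledAngle hs (hα _), Finset.sum_add_distrib, ← Finset.sum_div,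
    ← Finset.mul_sum]
  have h2 : 0 ≤ 1 - 1 / s ^ 2 := by
    rw [sub_nonneg, div_le_one (by positivity)]
    exact one_le_pow₀ hs1
  have h3 : 0 ≤ ∑ i, (y (i - 1) - y i) ^ 2 / (2 * Real.tan (α i / 2)) :=
    Finset.sum_nonneg fun i _ => by
      have := tan_half_pos (hα i)
      positivity
  positivity

/-- A null vector of a semidefinite form lies in its kernel. Here this gives orthogonality to the
hyperplane; as y is also orthogonal to 1, it is orthogonal to everything. -/
theorem signedLength_eq_zero_of_pairing_self_eq_zero (α y : Fin n → ℝ)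
    (hα : ∀ i, α i ∈ Set.Ioo 0 Real.pi) (hω : totalAngle α ≤ 2 * Real.pi)
    (hy : pairing α 1 y = 0) (hyy : pairing α y y = 0) (i : Fin n) : signedLength α y i = 0 := by
  have horth : ∀ z, pairing α 1 z = 0 → pairing α y z = 0 := by
    intro z hz
    have key : ∀ c : ℝ, 2 * c * pairing α y z + c ^ 2 * pairing α z z ≤ 0 := by
      intro c
      have := pairing_self_nonpos α (y + c • z) hα hω (by
        rw [pairing_add_right, pairing_smul_right, hy, hz, mul_zero, add_zero])
      rw [pairing_add_self, hyy, pairing_smul_right, pairing_smul_right, pairing_comm α (c • z),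
        pairing_smul_right] at this
      linarith
    have hz' := pairing_self_nonpos α z hα hω hz
    by_contra h0
    -- The 1 in the denominator keeps it positive even when `pairing α z z = 0`.
    have h1 := key (pairing α y z / (1 - pairing α z z))
    have h2 : 0 < 1 - pairing α z z := by linarith
    have h3 : 2 * (pairing α y z / (1 - pairing α z z)) * pairing α y z +
        (pairing α y z / (1 - pairing α z z)) ^ 2 * pairing α z z =
        pairing α y z ^ 2 * (2 - pairing α z z) / (1 - pairing α z z) ^ 2 := by
      field_simp
      ring
    rw [h3] at h1
    have h4 : 0 < 2 - pairing α z z := by linarith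
    have : 0 < pairing α y z ^ 2 * (2 - pairing α z z) / (1 - pairing α z z) ^ 2 := by positivity
    linarith
  have hpos := pairing_one_one_pos α hα
  have hall : ∀ z, pairing α y z = 0 := by
    intro z
    have h1 := horth (z + (-(pairing α 1 z / pairing α 1 1)) • (1 : Fin n → ℝ)) (by
      rw [pairing_add_right, pairing_smul_right]
      field_simp
      ring)
    rwa [pairing_add_right, pairing_smul_right, pairing_comm α y 1, hy, mul_zero, add_zero] at h1
  have h2 := hall (Pi.single i 1)
  rw [pairing_comm, pairing] at h2
  simpa [Pi.single_apply] using h2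

/-- The support numbers z of a point, taken for the scaled angles, have zero mean and zero energy.
For the original angles only the remainder is left, and it is negative because s < 1. -/
theorem exists_pairing_self_pos (α : Fin n → ℝ) (hα : ∀ i, α i ∈ Set.Ioo 0 Real.pi)
    (hω : 2 * Real.pi < totalAngle α) : ∃ z, pairing α 1 z = 0 ∧ 0 < pairing α z z := by
  have hn : 2 < n := by
    have h1 : totalAngle α < ∑ _i : Fin n, Real.pi :=
      Finset.sum_lt_sum_of_nonempty Finset.univ_nonempty fun i _ => (hα i).2
    simp only [Finset.sum_const, Finset.card_univ, Fintype.card_fin, nsmul_eq_mul] at h1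
    have : (2 : ℝ) < n := lt_of_mul_lt_mul_right (hω.trans h1) Real.pi_pos.le
    exact_mod_cast this
  obtain ⟨s, hs, hsum⟩ := exists_sum_scaledAngle_eq α hα hn
  have hs1 : s < 1 := by
    by_contra! h
    have : ∑ i, scaledAngle 1 (α i) ≤ ∑ i, scaledAngle s (α i) :=
      Finset.sum_le_sum fun i _ => scaledAngle_le_of_le h (hα i)
    simp only [scaledAngle_one (hα _)] at this
    unfold totalAngle at hω
    linarith
  set γ : Fin n → ℝ := fun i => scaledAngle s (α i) with hγ_def
  have hγ : ∀ i, γ i ∈ Set.Ioo 0 Real.pi := fun i => scaledAngle_mem hs (hα i)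
  obtain ⟨u, hu⟩ : ∃ u : ℂ, (u * Complex.exp (-(rayAngle γ 0 * Complex.I))).re ≠ 0 :=
    ⟨Complex.exp (rayAngle γ 0 * Complex.I), by
      rw [← Complex.exp_add, add_neg_cancel, Complex.exp_zero]
      simp⟩
  set z : Fin n → ℝ := fun i => (u * Complex.exp (-(rayAngle γ i * Complex.I))).re with hz
  have hlen := signedLength_of_point γ z hγ hsum u fun _ => rfl
  have hmean : ∑ i, (z (i - 1) + z i) * Real.tan (α i / 2) = 0 := by
    have h1 := sum_signedLength_eq γ z
    rw [Finset.sum_congr rfl fun i _ => hlen i, Finset.sum_const_zero] at h1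
    simp only [hγ_def, tan_half_scaledAngle, mul_left_comm _ s, ← Finset.mul_sum] at h1
    exact (mul_eq_zero.1 h1.symm).resolve_left hs.ne'
  have hE : ∑ i, arcEnergy (scaledAngle s (α i)) (z (i - 1)) (z i) = 0 := by
    have h1 := pairing_self_eq γ z
    simp only [pairing, hlen, mul_zero, Finset.sum_const_zero] at h1
    linarith
  have h1z : pairing α 1 z = 0 := by rw [pairing_one_left, sum_signedLength_eq, hmean]
  refine ⟨z, h1z, ?_⟩
  rw [pairing_self_eq]
  simp only [arcEnergy_eq_scaledAngle hs (hα _), Finset.sum_add_distrib, ← Finset.sum_div,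
    ← Finset.mul_sum]
  rw [hE, zero_div, zero_add, ← neg_mul]
  refine mul_pos ?_ ?_
  · rw [neg_sub, sub_pos, one_lt_div (by positivity)]
    exact pow_lt_one₀ hs.le hs1 two_ne_zero
  · have hnn : ∀ i ∈ Finset.univ, 0 ≤ (z (i - 1) - z i) ^ 2 / (2 * Real.tan (α i / 2)) :=
      fun i _ => by
        have := tan_half_pos (hα i)
        positivity
    -- If the remainder vanished, z would be constant and, by the choice of u, nonzero,
    -- contradicting its zero mean.
    refine (Finset.sum_nonneg hnn).lt_of_ne' fun h0 => ?_
    have heq : ∀ i, z (i - 1) = z i := by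
      intro i
      have h2 := (Finset.sum_eq_zero_iff_of_nonneg hnn).1 h0 i (Finset.mem_univ i)
      have := (tan_half_pos (hα i)).ne'
      simpa [this, sub_eq_zero] using h2
    have hconst : ∀ k (hk : k < n), z ⟨k, hk⟩ = z 0 := by
      intro k
      induction k with
      | zero => exact fun _ => rfl
      | succ k ih =>
        intro hk
        rw [← ih (by omega), ← heq ⟨k + 1, hk⟩]
        congr 1
        rw [sub_eq_iff_eq_add]
        exact Fin.ext (Fin.val_add_one_of_succ_lt (i := ⟨k, by omega⟩) hk).symm
    have hz1 : z = z 0 • (1 : Fin n → ℝ) := by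
      ext i
      simpa using hconst i.1 i.2
    rw [hz1, pairing_smul_right] at h1z
    exact (mul_ne_zero hu (pairing_one_one_pos α hα).ne') h1z

end Comparison

/-! ### Area on the cone in polar coordinates -/

section ConeArea

open MeasureTheory

theorem Cone.polar_eq_polar_iff {ω : ℝ} {r s : ℝ≥0} {θ φ : ℝ} :
    Cone.polar ω r θ = Cone.polar ω s φ ↔ r = s ∧ (r = 0 ∨ ∃ k : ℤ, φ = θ + k * ω) := by
  have h : Cone.polar ω r θ = Cone.polar ω s φ ↔
      r = s ∧ (r = 0 ∨ (θ : AddCircle ω) = (φ : AddCircle ω)) := Quotient.eq (r := coneSetoid ω)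
  rw [h, eq_comm (a := (θ : AddCircle ω)), QuotientAddGroup.eq_iff_sub_mem]
  simp only [AddSubgroup.mem_zmultiples_iff, zsmul_eq_mul, eq_sub_iff_add_eq, eq_comm (b := φ),
    add_comm _ θ]

/-- The area density of a set at the angle `θ`. -/
def sliceArea (ω : ℝ) (S : Set (Cone ω)) (θ : ℝ) : ℝ≥0∞ :=
  ∫⁻ r in Set.Ioi (0 : ℝ), {r : ℝ | Cone.polar ω r.toNNReal θ ∈ S}.indicator ENNReal.ofReal r

theorem areaMeasure_eq_lintegral {ω : ℝ} {S : Set (Cone ω)} (hS : MeasurableSet S) :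
    Cone.areaMeasure ω S = ∫⁻ θ in Set.Ico 0 ω, sliceArea ω S θ := by
  have hm := Cone.measurable_polar ω hS
  rw [Cone.areaMeasure, Measure.map_apply (Cone.measurable_polar ω) hS, withDensity_apply _ hm,
    ← lintegral_indicator hm, Measure.volume_eq_prod, ← Measure.prod_restrict,
    lintegral_prod_symm]
  · rfl
  · exact ((ENNReal.measurable_ofReal.comp measurable_fst).indicator hm).aemeasurable

theorem sliceArea_add_int_mul (ω : ℝ) (S : Set (Cone ω)) (θ : ℝ) (k : ℤ) :
    sliceArea ω S (k * ω + θ) = sliceArea ω S θ := by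
  have : ∀ r : ℝ≥0, Cone.polar ω r (k * ω + θ) = Cone.polar ω r θ := fun r =>
    Cone.polar_eq_polar_iff.2 ⟨rfl, Or.inr ⟨-k, by push_cast; ring⟩⟩
  simp only [sliceArea, this]

/-- The density has period ω, so the window of angles may start anywhere, in particular at a vertex
of the polygon. -/
theorem areaMeasure_eq_lintegral_Ioc {ω : ℝ} (hω : 0 < ω) {S : Set (Cone ω)}
    (hS : MeasurableSet S) (c : ℝ) :
    Cone.areaMeasure ω S = ∫⁻ θ in Set.Ioc c (c + ω), sliceArea ω S θ := by
  rw [areaMeasure_eq_lintegral hS, setLIntegral_congr Ico_ae_eq_Ioc]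
  have h := (isAddFundamentalDomain_Ioc hω 0 volume).setLIntegral_eq
    (isAddFundamentalDomain_Ioc hω c volume) (sliceArea ω S) (by
      rintro ⟨g, hg⟩ x
      obtain ⟨k, rfl⟩ := AddSubgroup.mem_zmultiples_iff.1 hg
      rw [AddSubgroup.vadd_def, vadd_eq_add]
      simpa only [zsmul_eq_mul] using sliceArea_add_int_mul ω S x k)
  rwa [zero_add] at h

theorem lintegral_Ioc_zero_ofReal {c : ℝ} (hc : 0 ≤ c) :
    ∫⁻ r in Set.Ioc 0 c, ENNReal.ofReal r = ENNReal.ofReal (c ^ 2 / 2) := by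
  rw [← ofReal_integral_eq_lintegral_ofReal, ← intervalIntegral.integral_of_le hc, integral_id]
  · congr 1
    ring
  · exact (continuous_id.integrableOn_Icc).mono_set Set.Ioc_subset_Icc_self
  · exact (ae_restrict_mem measurableSet_Ioc).mono fun r hr => hr.1.le

theorem lintegral_Ioo_div_cos_sq {a b x c : ℝ} (hab : a ≤ b) (ha : -(Real.pi / 2) < a)
    (hb : b < Real.pi / 2) :
    ∫⁻ θ in Set.Ioo (c + a) (c + b), ENNReal.ofReal ((x / Real.cos (θ - c)) ^ 2 / 2) =
      ENNReal.ofReal (x ^ 2 / 2 * (Real.tan b - Real.tan a)) := by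
  have hab' : c + a ≤ c + b := by linarith
  have hcos : ∀ θ ∈ Set.Icc (c + a) (c + b), Real.cos (θ - c) ≠ 0 := fun θ hθ =>
    (Real.cos_pos_of_mem_Ioo ⟨by linarith [hθ.1], by linarith [hθ.2]⟩).ne'
  have hcont : ContinuousOn (fun θ => (x / Real.cos (θ - c)) ^ 2 / 2)
      (Set.Icc (c + a) (c + b)) := by
    refine ((continuousOn_const.div ?_ hcos).pow 2).div_const 2
    fun_prop
  rw [setLIntegral_congr Ioo_ae_eq_Ioc, ← ofReal_integral_eq_lintegral_ofReal,
    ← intervalIntegral.integral_of_le hab',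
    intervalIntegral.integral_eq_sub_of_hasDerivAt
      (f := fun θ => x ^ 2 / 2 * Real.tan (θ - c))]
  · rw [add_sub_cancel_left, add_sub_cancel_left, mul_sub]
  · intro θ hθ
    rw [Set.uIcc_of_le hab'] at hθ
    have h1 := (Real.hasDerivAt_tan (hcos θ hθ)).comp_sub_const θ c
    refine (h1.const_mul (x ^ 2 / 2)).congr_deriv ?_
    ring
  · rw [← Set.uIcc_of_le hab'] at hcont
    exact hcont.intervalIntegrable
  · exact hcont.integrableOn_Icc.mono_set Set.Ioc_subset_Icc_self
  · exact Filter.Eventually.of_forall fun θ => by positivity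

theorem lintegral_indicator_mul_cos_le {φ x : ℝ} (hφ : 0 < Real.cos φ) (hx : 0 ≤ x) :
    ∫⁻ r in Set.Ioi (0 : ℝ), {r : ℝ | r * Real.cos φ ≤ x}.indicator ENNReal.ofReal r =
      ENNReal.ofReal ((x / Real.cos φ) ^ 2 / 2) := by
  have : {r : ℝ | r * Real.cos φ ≤ x} = Set.Iic (x / Real.cos φ) := by
    ext r
    simp [le_div_iff₀ hφ]
  rw [this, lintegral_indicator measurableSet_Iic, Measure.restrict_restrict measurableSet_Iic,
    Set.inter_comm, Set.Ioi_inter_Iic, lintegral_Ioc_zero_ofReal (by positivity)]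

theorem mem_convexHull_zero_iff {s e z : ℂ} {x : ℝ} (hx : 0 < x) (hs : s.re = x) (he : e.re = x)
    (hse : s.im < e.im) :
    z ∈ convexHull ℝ {0, s, e} ↔
      0 ≤ z.re ∧ z.re ≤ x ∧ s.im * z.re ≤ x * z.im ∧ x * z.im ≤ e.im * z.re := by
  rw [convexHull_insert (by simp), convexHull_pair]
  simp only [mem_convexJoin, Set.mem_singleton_iff, exists_eq_left]
  constructor
  · rintro ⟨w, ⟨a, b, ha, hb, hab, rfl⟩, ⟨c, d, hc, hd, hcd, rfl⟩⟩
    simp only [smul_zero, zero_add, Complex.smul_re, Complex.add_re, Complex.smul_im,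
      Complex.add_im, smul_eq_mul, hs, he]
    have hx' : a * x + b * x = x := by rw [← add_mul, hab, one_mul]
    rw [hx']
    obtain rfl : a = 1 - b := by linarith
    refine ⟨by positivity, by nlinarith, ?_, ?_⟩
    · have : 0 ≤ x * d * b * (e.im - s.im) :=
        mul_nonneg (by positivity) (by linarith)
      linarith
    · have : 0 ≤ x * d * (1 - b) * (e.im - s.im) :=
        mul_nonneg (by positivity) (by linarith)
      linarith
  · rintro ⟨h0, h1, h2, h3⟩
    rcases h0.eq_or_lt with h0 | h0
    · have hz : z = 0 := by
        rw [← h0] at h2 h3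
        exact Complex.ext h0.symm (by
          have : x * z.im = 0 := by linarith
          simpa [hx.ne'] using this)
      exact ⟨s, left_mem_segment ℝ s e, hz ▸ left_mem_segment ℝ 0 s⟩
    have hd : 0 < e.im - s.im := by linarith
    refine ⟨((e.im - x * z.im / z.re) / (e.im - s.im)) • s +
        ((x * z.im / z.re - s.im) / (e.im - s.im)) • e,
      ⟨_, _, ?_, ?_, ?_, rfl⟩, ⟨1 - z.re / x, z.re / x, ?_, by positivity, by ring, ?_⟩⟩
    · refine div_nonneg ?_ hd.le
      rw [sub_nonneg, div_le_iff₀ h0]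
      exact h3
    · refine div_nonneg ?_ hd.le
      rw [sub_nonneg, le_div_iff₀ h0]
      exact h2
    · field_simp
      ring
    · rw [sub_nonneg, div_le_one hx]
      exact h1
    · apply Complex.ext
      · simp only [smul_zero, zero_add, Complex.smul_re, Complex.add_re, smul_eq_mul, hs, he]
        field_simp
        ring
      · simp only [smul_zero, zero_add, Complex.smul_im, Complex.add_im, smul_eq_mul]
        field_simp
        ring

theorem arg_mem_Ioo_of_re_pos {z : ℂ} (hz : 0 < z.re) :
    z.arg ∈ Set.Ioo (-(Real.pi / 2)) (Real.pi / 2) := by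
  rw [Set.mem_Ioo, ← abs_lt, Complex.abs_arg_lt_pi_div_two_iff]
  exact Or.inl hz

theorem polar_mem_convexHull_iff {s e : ℂ} {x r φ : ℝ} (hx : 0 < x) (hs : s.re = x)
    (he : e.re = x) (hse : s.im < e.im) (hr : 0 < r) (hφ : φ ∈ Set.Ioc (-Real.pi) Real.pi) :
    (r * Complex.exp (φ * Complex.I)) ∈ convexHull ℝ {0, s, e} ↔
      φ ∈ Set.Icc s.arg e.arg ∧ r * Real.cos φ ≤ x := by
  have hs' := arg_mem_Ioo_of_re_pos (hs.symm ▸ hx : 0 < s.re)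
  have he' := arg_mem_Ioo_of_re_pos (he.symm ▸ hx : 0 < e.re)
  have e1 : s.im = x * Real.tan s.arg := by rw [Complex.tan_arg, hs]; field_simp
  have e2 : e.im = x * Real.tan e.arg := by rw [Complex.tan_arg, he]; field_simp
  rw [mem_convexHull_zero_iff hx hs he hse]
  simp only [Complex.re_ofReal_mul, Complex.im_ofReal_mul, Complex.exp_ofReal_mul_I_re,
    Complex.exp_ofReal_mul_I_im]
  have hmono := Real.strictMonoOn_tan
  have hcase : φ ∈ Set.Ioo (-(Real.pi / 2)) (Real.pi / 2) →
      ((s.im * (r * Real.cos φ) ≤ x * (r * Real.sin φ) ∧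
        x * (r * Real.sin φ) ≤ e.im * (r * Real.cos φ)) ↔ φ ∈ Set.Icc s.arg e.arg) := by
    intro h
    have hc := Real.cos_pos_of_mem_Ioo h
    have ht : Real.sin φ = Real.tan φ * Real.cos φ := (Real.tan_mul_cos hc.ne').symm
    have hp : 0 < x * r * Real.cos φ := by positivity
    rw [Set.mem_Icc, ← hmono.le_iff_le hs' h, ← hmono.le_iff_le h he', e1, e2, ht,
      ← mul_le_mul_iff_right₀ (b := Real.tan s.arg) hp,
      ← mul_le_mul_iff_right₀ (b := Real.tan φ) hp]
    ring_nf
  constructor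
  · rintro ⟨h0, h1, h2, h3⟩
    have hc : 0 < Real.cos φ := by
      refine (nonneg_of_mul_nonneg_right h0 hr).lt_of_ne' fun hc => ?_
      rw [hc] at h2 h3
      have hz : x * r * Real.sin φ = 0 := by linarith
      have hsin : Real.sin φ = 0 := (mul_eq_zero.1 hz).resolve_left (by positivity)
      have := Real.sin_sq_add_cos_sq φ
      rw [hc, hsin] at this
      norm_num at this
    have h : φ ∈ Set.Ioo (-(Real.pi / 2)) (Real.pi / 2) := by
      constructor
      · by_contra! hle
        have := Real.cos_nonpos_of_pi_div_two_le_of_le (x := -φ) (by linarith)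
          (by linarith [hφ.1, Real.pi_pos])
        rw [Real.cos_neg] at this
        linarith
      · by_contra! hle
        have := Real.cos_nonpos_of_pi_div_two_le_of_le (x := φ) hle
          (by linarith [hφ.2, Real.pi_pos])
        linarith
    exact ⟨(hcase h).1 ⟨h2, h3⟩, h1⟩
  · rintro ⟨h, h1⟩
    have h' : φ ∈ Set.Ioo (-(Real.pi / 2)) (Real.pi / 2) :=
      ⟨hs'.1.trans_le h.1, h.2.trans_lt he'.2⟩
    exact ⟨mul_nonneg hr.le (Real.cos_pos_of_mem_Ioo h').le, h1, (hcase h').2 h⟩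

end ConeArea

/-! ### Area of a convex polygon -/

section PolygonArea

open MeasureTheory

variable {n : ℕ} [NeZero n] {α : Fin n → ℝ}

theorem startPoint_arg_mem (x : Fin n → ℝ) {i : Fin n} (hx : 0 < x i) :
    (startPoint α x i).arg ∈ Set.Ioo (-(Real.pi / 2)) (Real.pi / 2) :=
  arg_mem_Ioo_of_re_pos hx

theorem endPoint_arg_mem (x : Fin n → ℝ) {i : Fin n} (hx : 0 < x i) :
    (endPoint α x i).arg ∈ Set.Ioo (-(Real.pi / 2)) (Real.pi / 2) :=
  arg_mem_Ioo_of_re_pos hx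

theorem endPoint_arg_eq (x : Fin n → ℝ) (hα : ∀ i, α i ∈ Set.Ioo 0 Real.pi) (hx : ∀ i, 0 < x i)
    (i : Fin n) :
    (endPoint α x i).arg = α (i + 1) + (startPoint α x (i + 1)).arg := by
  have h0 : startPoint α x (i + 1) ≠ 0 := fun h => (hx (i + 1)).ne' (congrArg Complex.re h)
  have h1 := Complex.arg_mul_coe_angle (Complex.exp_ne_zero (α (i + 1) * Complex.I)) h0
  rw [← endPoint_eq_exp_mul_startPoint α x hα, Complex.arg_exp_mul_I,
    Real.Angle.coe_toIocMod, ← Real.Angle.coe_add, Real.Angle.angle_eq_iff_two_pi_dvd_sub] at h1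
  obtain ⟨k, hk⟩ := h1
  have h2 := endPoint_arg_mem (α := α) x (hx i)
  have h3 := startPoint_arg_mem (α := α) x (hx (i + 1))
  have h4 := hα (i + 1)
  have hpos := Real.pi_pos
  -- Arguments add only modulo 2π; the bounds on the three angles leave no room for a nonzero
  -- multiple.
  have hk1 : (k : ℝ) < 1 := by
    by_contra! h
    nlinarith [h2.2, h3.1, h4.1]
  have hk2 : (-1 : ℝ) < k := by
    by_contra! h
    nlinarith [h2.1, h3.2, h4.2]
  have : k = 0 := by
    have a1 : k < 1 := by exact_mod_cast hk1
    have a2 : -1 < k := by exact_mod_cast hk2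
    omega
  rw [this] at hk
  simp at hk
  linarith

namespace ConvexPolygon

theorem startPoint_im_lt (P : ConvexPolygon α) (i : Fin n) :
    (startPoint α P.support i).im < (endPoint α P.support i).im :=
  sub_pos.1 (P.signedLength_pos i)

theorem startPoint_arg_lt (P : ConvexPolygon α) (i : Fin n) :
    (startPoint α P.support i).arg < (endPoint α P.support i).arg := by
  have hx := P.support_pos i
  have h := P.startPoint_im_lt i
  refine (Real.strictMonoOn_tan.lt_iff_lt (startPoint_arg_mem P.support hx)
    (endPoint_arg_mem P.support hx)).1 ?_
  rw [Complex.tan_arg, Complex.tan_arg]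
  exact div_lt_div_of_pos_right h hx

theorem polar_mem_region_iff (P : ConvexPolygon α) {r : ℝ≥0} (hr : 0 < r) (θ : ℝ) :
    Cone.polar (totalAngle α) r θ ∈ P.region ↔
      ∃ i, ∃ k : ℤ, θ + k * totalAngle α - rayAngle α i ∈
          Set.Icc (startPoint α P.support i).arg (endPoint α P.support i).arg ∧
        r * Real.cos (θ + k * totalAngle α - rayAngle α i) ≤ P.support i := by
  simp only [region, Set.mem_iUnion, Set.mem_image]
  refine exists_congr fun i => ?_
  have hx := P.support_pos i
  have hiff := fun φ => polar_mem_convexHull_iff (s := startPoint α P.support i)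
    (e := endPoint α P.support i) (r := r) (φ := φ) hx rfl rfl (P.startPoint_im_lt i) hr
  have hs := startPoint_arg_mem (α := α) P.support hx
  have he := endPoint_arg_mem (α := α) P.support hx
  constructor
  · rintro ⟨z, hz, hzr⟩
    obtain ⟨h1, h2⟩ := Cone.polar_eq_polar_iff.1 hzr.symm
    obtain ⟨k, hk⟩ := h2.resolve_left hr.ne'
    have hz' : z = r * Complex.exp (z.arg * Complex.I) := by
      rw [h1, coe_nnnorm, Complex.norm_mul_exp_arg_mul_I]
    rw [hz', hiff _ ⟨Complex.neg_pi_lt_arg z, Complex.arg_le_pi z⟩] at hz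
    refine ⟨k, ?_⟩
    have : θ + k * totalAngle α - rayAngle α i = z.arg := by linarith
    rwa [this]
  · rintro ⟨k, hk⟩
    have hφ : θ + k * totalAngle α - rayAngle α i ∈ Set.Ioc (-Real.pi) Real.pi :=
      ⟨by linarith [hk.1.1, hs.1, Real.pi_pos], by linarith [hk.1.2, he.2, Real.pi_pos]⟩
    refine ⟨_, (hiff _ hφ).2 hk, ?_⟩
    rw [Cone.ofPlane, eq_comm]
    refine Cone.polar_eq_polar_iff.2 ⟨?_, Or.inr ⟨k, ?_⟩⟩
    · apply NNReal.eq
      rw [coe_nnnorm, norm_mul, Complex.norm_exp_ofReal_mul_I, mul_one]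
      simp
    · rw [Complex.arg_real_mul _ (NNReal.coe_pos.2 hr), Complex.arg_exp_mul_I,
        (toIocMod_eq_self _).2 ⟨hφ.1, by linarith [hφ.2]⟩]
      ring

theorem measurableSet_region (P : ConvexPolygon α) : MeasurableSet P.region := by
  -- Measurability on the quotient is tested upstairs, where the preimage is the apex fibre together
  -- with a countable union of closed sets.
  change MeasurableSet (Quotient.mk (coneSetoid (totalAngle α)) ⁻¹' P.region)
  have : Quotient.mk (coneSetoid (totalAngle α)) ⁻¹' P.region = {p | p.1 = 0} ∪
      ⋃ i, ⋃ k : ℤ, {p : ℝ≥0 × ℝ | p.2 + k * totalAngle α - rayAngle α i ∈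
          Set.Icc (startPoint α P.support i).arg (endPoint α P.support i).arg ∧
        p.1 * Real.cos (p.2 + k * totalAngle α - rayAngle α i) ≤ P.support i} := by
    ext ⟨r, θ⟩
    simp only [Set.mem_union, Set.mem_ofPred_eq, Set.mem_iUnion]
    rcases eq_or_ne r 0 with rfl | hr
    · simp only [true_or, iff_true]
      refine Set.mem_iUnion.2 ⟨0, 0, subset_convexHull ℝ _ (by simp), ?_⟩
      refine Cone.polar_eq_polar_iff.2 ⟨by simp, Or.inl (by simp)⟩
    · simp only [hr, false_or]
      exact P.polar_mem_region_iff (pos_iff_ne_zero.2 hr) θ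
  rw [this]
  refine (measurableSet_eq_fun measurable_fst measurable_const).union
    (MeasurableSet.iUnion fun i => MeasurableSet.iUnion fun k => IsClosed.measurableSet ?_)
  have h1 : Continuous fun p : ℝ≥0 × ℝ => p.2 + k * totalAngle α - rayAngle α i := by fun_prop
  exact (isClosed_Icc.preimage h1).inter (isClosed_le (f := fun p : ℝ≥0 × ℝ =>
    p.1 * Real.cos (p.2 + k * totalAngle α - rayAngle α i)) (by fun_prop) continuous_const)

/-- The angles of the vertices, in a universal cover of the punctured cone. -/
def vertexAngle (P : ConvexPolygon α) (k : ℕ) : ℝ :=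
  rayAngle α 0 + (startPoint α P.support 0).arg + ∑ j ∈ Finset.range k,
    ((endPoint α P.support (Fin.ofNat n j)).arg - (startPoint α P.support (Fin.ofNat n j)).arg)

theorem vertexAngle_succ (P : ConvexPolygon α) (i : Fin n) :
    P.vertexAngle (i.val + 1) = P.vertexAngle i.val +
      ((endPoint α P.support i).arg - (startPoint α P.support i).arg) := by
  have h : Fin.ofNat n i.val = i := by simp
  rw [vertexAngle, Finset.sum_range_succ, ← add_assoc, vertexAngle, h]

theorem strictMono_vertexAngle (P : ConvexPolygon α) : StrictMono P.vertexAngle := by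
  refine strictMono_nat_of_lt_succ fun k => ?_
  rw [vertexAngle, vertexAngle, Finset.sum_range_succ]
  linarith [P.startPoint_arg_lt (Fin.ofNat n k)]

theorem vertexAngle_val (P : ConvexPolygon α) (hα : ∀ i, α i ∈ Set.Ioo 0 Real.pi) (i : Fin n) :
    P.vertexAngle i.val = rayAngle α i + (startPoint α P.support i).arg := by
  obtain ⟨k, hk⟩ := i
  induction k with
  | zero =>
    simp only [vertexAngle, Finset.sum_range_zero, add_zero]
    rfl
  | succ k ih =>
    have h1 := P.vertexAngle_succ ⟨k, by omega⟩
    have h2 : (⟨k, by omega⟩ : Fin n) + 1 = ⟨k + 1, hk⟩ :=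
      Fin.ext (Fin.val_add_one_of_succ_lt (i := ⟨k, by omega⟩) hk)
    have h3 := rayAngle_add_one_of_lt α (i := ⟨k, by omega⟩) hk
    have h4 := endPoint_arg_eq P.support hα P.support_pos ⟨k, by omega⟩
    rw [h2] at h3 h4
    simp only at h1 ⊢
    rw [h1, ih (by omega)]
    linarith

theorem vertexAngle_val_succ (P : ConvexPolygon α) (hα : ∀ i, α i ∈ Set.Ioo 0 Real.pi)
    (i : Fin n) :
    P.vertexAngle (i.val + 1) = rayAngle α i + (endPoint α P.support i).arg := by
  rw [vertexAngle_succ, vertexAngle_val P hα]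
  ring

theorem vertexAngle_card (P : ConvexPolygon α) (hα : ∀ i, α i ∈ Set.Ioo 0 Real.pi) :
    P.vertexAngle n = P.vertexAngle 0 + totalAngle α := by
  have hn : n - 1 + 1 = n := Nat.sub_add_cancel NeZero.one_le
  set i : Fin n := ⟨n - 1, by omega⟩ with hi
  have h1 := P.vertexAngle_val_succ hα i
  have h2 := P.vertexAngle_val hα 0
  have h3 := endPoint_arg_eq P.support hα P.support_pos i
  have h4 := rayAngle_add_one_of_eq α (i := i) hn
  have h5 : i.val + 1 = n := hn
  rw [Fin.add_one_eq_zero_of_succ_eq h5] at h3 h4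
  rw [h5] at h1
  simp only [Fin.val_zero] at h2
  linarith

/-- The vertex angles cover exactly one period, so over an open sector between consecutive vertices
a single triangle, with no winding, bounds the radius. -/
theorem sliceArea_region (P : ConvexPolygon α) (hα : ∀ i, α i ∈ Set.Ioo 0 Real.pi) (i : Fin n)
    {θ : ℝ} (hθ : θ ∈ Set.Ioo (P.vertexAngle i.val) (P.vertexAngle (i.val + 1))) :
    sliceArea (totalAngle α) P.region θ =
      ENNReal.ofReal ((P.support i / Real.cos (θ - rayAngle α i)) ^ 2 / 2) := by
  have hθ' := hθ
  rw [P.vertexAngle_val hα, P.vertexAngle_val_succ hα] at hθ'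
  have hx := P.support_pos i
  have hs := startPoint_arg_mem (α := α) P.support hx
  have he := endPoint_arg_mem (α := α) P.support hx
  have hcos : 0 < Real.cos (θ - rayAngle α i) :=
    Real.cos_pos_of_mem_Ioo ⟨by linarith [hθ'.1, hs.1], by linarith [hθ'.2, he.2]⟩
  have hω : 0 < totalAngle α := Finset.sum_pos (fun i _ => (hα i).1) Finset.univ_nonempty
  have hmono := P.strictMono_vertexAngle
  rw [← lintegral_indicator_mul_cos_le hcos hx.le, sliceArea]
  refine setLIntegral_congr_fun measurableSet_Ioi fun r hr => ?_
  have hr' : 0 < r.toNNReal := Real.toNNReal_pos.2 hr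
  have hiff : r ∈ {r : ℝ | Cone.polar (totalAngle α) r.toNNReal θ ∈ P.region} ↔
      r ∈ {r : ℝ | r * Real.cos (θ - rayAngle α i) ≤ P.support i} := by
    rw [Set.mem_ofPred_eq, Set.mem_ofPred_eq, P.polar_mem_region_iff hr' θ,
      Real.coe_toNNReal r (le_of_lt hr)]
    constructor
    · rintro ⟨j, k, hk, hle⟩
      have h1 : θ + k * totalAngle α ∈
          Set.Icc (P.vertexAngle j.val) (P.vertexAngle (j.val + 1)) := by
        rw [P.vertexAngle_val hα, P.vertexAngle_val_succ hα]
        exact ⟨by linarith [hk.1], by linarith [hk.2]⟩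
      have h0 := hmono.monotone (Nat.zero_le j.val)
      have h0' := hmono.monotone (Nat.zero_le i.val)
      have h2 := hmono.monotone (Nat.succ_le_of_lt j.isLt)
      have h2' := hmono.monotone (Nat.succ_le_of_lt i.isLt)
      have h3 := P.vertexAngle_card hα
      simp only [Nat.succ_eq_add_one] at h2 h2'
      have hk1 : (k : ℝ) < 1 := by
        by_contra! h
        nlinarith [h1.2, hθ.1]
      have hk2 : (-1 : ℝ) < k := by
        by_contra! h
        nlinarith [h1.1, hθ.2]
      have hk0 : k = 0 := by
        have a1 : k < 1 := by exact_mod_cast hk1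
        have a2 : -1 < k := by exact_mod_cast hk2
        omega
      rw [hk0, Int.cast_zero, zero_mul, add_zero] at h1 hle
      have hij : j = i := by
        apply Fin.ext
        have a1 := hmono.lt_iff_lt.1 (h1.1.trans_lt hθ.2)
        have a2 := hmono.lt_iff_lt.1 (hθ.1.trans_le h1.2)
        omega
      rwa [hij] at hle
    · intro hle
      refine ⟨i, 0, ?_⟩
      rw [Int.cast_zero, zero_mul, add_zero]
      exact ⟨⟨by linarith [hθ'.1], by linarith [hθ'.2]⟩, hle⟩
  by_cases h : r ∈ {r : ℝ | r * Real.cos (θ - rayAngle α i) ≤ P.support i}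
  · rw [Set.indicator_of_mem (hiff.2 h), Set.indicator_of_mem h]
  · rw [Set.indicator_of_notMem (mt hiff.1 h), Set.indicator_of_notMem h]

theorem lintegral_sliceArea_region (P : ConvexPolygon α) (hα : ∀ i, α i ∈ Set.Ioo 0 Real.pi)
    (i : Fin n) :
    ∫⁻ θ in Set.Ioc (P.vertexAngle i.val) (P.vertexAngle (i.val + 1)),
      sliceArea (totalAngle α) P.region θ =
      ENNReal.ofReal (P.support i * signedLength α P.support i / 2) := by
  have hx := P.support_pos i
  rw [← setLIntegral_congr Ioo_ae_eq_Ioc,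
    setLIntegral_congr_fun measurableSet_Ioo fun θ hθ => P.sliceArea_region hα i hθ,
    P.vertexAngle_val hα, P.vertexAngle_val_succ hα,
    lintegral_Ioo_div_cos_sq (P.startPoint_arg_lt i).le
      (startPoint_arg_mem P.support hx).1 (endPoint_arg_mem P.support hx).2]
  congr 1
  rw [Complex.tan_arg, Complex.tan_arg, signedLength, Complex.sub_im]
  simp only [startPoint, endPoint]
  field_simp

theorem area_eq (P : ConvexPolygon α) (hα : ∀ i, α i ∈ Set.Ioo 0 Real.pi) :
    P.area = ENNReal.ofReal (pairing α P.support P.support / 2) := by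
  have hω : 0 < totalAngle α := Finset.sum_pos (fun i _ => (hα i).1) Finset.univ_nonempty
  have hmono := P.strictMono_vertexAngle
  have hsum : ∀ k, ∫⁻ θ in Set.Ioc (P.vertexAngle 0) (P.vertexAngle k),
      sliceArea (totalAngle α) P.region θ = ∑ j ∈ Finset.range k,
        ∫⁻ θ in Set.Ioc (P.vertexAngle j) (P.vertexAngle (j + 1)),
          sliceArea (totalAngle α) P.region θ := by
    intro k
    induction k with
    | zero => simp
    | succ k ih =>
      rw [Finset.sum_range_succ, ← ih, ← Set.Ioc_union_Ioc_eq_Ioc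
        (hmono.monotone (Nat.zero_le k)) (hmono.monotone (Nat.le_succ k)),
        lintegral_union measurableSet_Ioc]
      exact Set.Ioc_disjoint_Ioc_of_le le_rfl
  rw [area, areaMeasure_eq_lintegral_Ioc hω P.measurableSet_region (P.vertexAngle 0),
    ← P.vertexAngle_card hα, hsum, Finset.sum_range]
  simp only [P.lintegral_sliceArea_region hα]
  rw [← ENNReal.ofReal_sum_of_nonneg, pairing, Finset.sum_div]
  exact fun i _ => div_nonneg (mul_nonneg (P.support_pos i).le (P.signedLength_pos i).le) two_pos.le

end ConvexPolygon

end PolygonArea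

/-! ### Circumscribed polygons, optimality and translations -/

namespace ConvexPolygon

variable {n : ℕ} [NeZero n] {α : Fin n → ℝ}

theorem perimeter_eq (P : ConvexPolygon α) : P.perimeter = pairing α 1 P.support := by
  rw [pairing_one_left, perimeter]
  refine Finset.sum_congr rfl fun i => fun _ => ?_
  rw [Complex.dist_of_re_eq (z := startPoint α P.support i) (w := endPoint α P.support i) rfl,
    Real.dist_eq, abs_sub_comm, ← Complex.sub_im]
  exact abs_of_pos (P.signedLength_pos i)

/-- The polygon whose sides are tangent to the circle of radius `r`. -/
def circumscribed (hα : ∀ i, α i ∈ Set.Ioo 0 Real.pi) {r : ℝ} (hr : 0 < r) : ConvexPolygon α where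
  support := r • 1
  support_pos _ := by simpa using hr
  signedLength_pos i := by
    rw [signedLength_smul]
    exact mul_pos hr (signedLength_one_pos α hα i)

theorem isTangentAt_iff (P : ConvexPolygon α) (i : Fin n) {r : ℝ} (hr : 0 < r) {q : ℂ} :
    (EuclideanGeometry.Sphere.mk (0 : ℂ) r).IsTangentAt q
      (line[ℝ, startPoint α P.support i, endPoint α P.support i]) ↔
        P.support i = r ∧ q = r := by
  have hlt := P.startPoint_im_lt i
  have hmem : ∀ z : ℂ, z ∈ line[ℝ, startPoint α P.support i, endPoint α P.support i] ↔
      z.re = P.support i := by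
    intro z
    rw [mem_affineSpan_pair_iff_exists_lineMap_eq]
    constructor
    · rintro ⟨t, rfl⟩
      simp [AffineMap.lineMap_apply, startPoint, endPoint]
    · intro hz
      refine ⟨(z.im - (startPoint α P.support i).im) /
        ((endPoint α P.support i).im - (startPoint α P.support i).im), ?_⟩
      have : (endPoint α P.support i).im - (startPoint α P.support i).im ≠ 0 := by linarith
      apply Complex.ext
      · simp only [AffineMap.lineMap_apply, vsub_eq_sub, vadd_eq_add, Complex.add_re,
          Complex.smul_re, Complex.sub_re, hz]
        simp [startPoint, endPoint]
      · simp only [AffineMap.lineMap_apply, vsub_eq_sub, vadd_eq_add, Complex.add_im,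
          Complex.smul_im, Complex.sub_im, smul_eq_mul]
        field_simp
        ring
  constructor
  · rintro ⟨h1, h2, h3⟩
    rw [hmem] at h2
    have h4 := h3 ((hmem _).2 rfl : startPoint α P.support i ∈ _)
    have h5 := h3 ((hmem _).2 rfl : endPoint α P.support i ∈ _)
    rw [EuclideanGeometry.Sphere.mem_orthRadius_iff_inner_left] at h4 h5
    have h6 : q.im = 0 := by
      have e1 : (startPoint α P.support i).re = P.support i := rfl
      have e2 : (endPoint α P.support i).re = P.support i := rfl
      simp only [vsub_eq_sub, sub_zero, Complex.inner, Complex.mul_re, Complex.conj_re,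
        Complex.conj_im, Complex.sub_re, Complex.sub_im, e1, e2, h2, sub_self] at h4 h5
      have : ((endPoint α P.support i).im - (startPoint α P.support i).im) * q.im = 0 := by
        linarith
      exact (mul_eq_zero.1 this).resolve_left (by linarith)
    have h7 : ‖q‖ = r := by simpa [EuclideanGeometry.mem_sphere] using h1
    have hq : q = (P.support i : ℂ) := Complex.ext h2 (by rw [h6, Complex.ofReal_im])
    rw [hq, Complex.norm_real, Real.norm_of_nonneg (P.support_pos i).le] at h7
    exact ⟨h7, by rw [hq, h7]⟩
  · rintro ⟨h1, rfl⟩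
    refine ⟨?_, (hmem _).2 (by simp [h1]), fun z hz => ?_⟩
    · simp [EuclideanGeometry.mem_sphere, abs_of_pos hr]
    · have hz' := (hmem z).1 hz
      rw [EuclideanGeometry.Sphere.mem_orthRadius_iff_inner_left]
      simp [Complex.inner, hz', h1]

theorem isCircumscribedAbout_iff (hα : ∀ i, α i ∈ Set.Ioo 0 Real.pi) (P : ConvexPolygon α) {r : ℝ} :
    P.IsCircumscribedAbout r ↔ 0 < r ∧ P.support = r • 1 := by
  refine and_congr_right fun hr => ?_
  simp only [P.isTangentAt_iff _ hr]
  constructor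
  · intro h
    ext i
    obtain ⟨q, -, hi, -⟩ := h i
    simpa using hi
  · intro h i
    have hi : ∀ j, P.support j = r := fun j => by rw [h]; simp
    refine ⟨r, ?_, hi i, rfl⟩
    have hs : (startPoint α P.support i).im = -(r * Real.tan (α i / 2)) := by
      rw [← one_sub_cos_div_sin]
      simp only [startPoint, hi]
      ring
    have he : (endPoint α P.support i).im = r * Real.tan (α (i + 1) / 2) := by
      rw [← one_sub_cos_div_sin]
      simp only [endPoint, hi]
      ring
    have h1 := tan_half_pos (hα i)
    have h2 := tan_half_pos (hα (i + 1))
    -- The tangency point splits the side into lengths r tan(α_i/2) and r tan(α_{i+1}/2), which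
    -- gives the convex weights.
    refine ⟨Real.tan (α (i + 1) / 2) / (Real.tan (α i / 2) + Real.tan (α (i + 1) / 2)),
      Real.tan (α i / 2) / (Real.tan (α i / 2) + Real.tan (α (i + 1) / 2)), by positivity,
      by positivity, by field_simp; ring, ?_⟩
    apply Complex.ext
    · simp only [Complex.add_re, Complex.smul_re, startPoint, endPoint, hi, Complex.ofReal_re,
        smul_eq_mul]
      field_simp
      ring
    · simp only [Complex.add_im, Complex.smul_im, hs, he, Complex.ofReal_im, smul_eq_mul]
      ring

theorem pairing_self_pos (P : ConvexPolygon α) : 0 < pairing α P.support P.support :=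
  Finset.sum_pos (fun i _ => mul_pos (P.support_pos i) (P.signedLength_pos i)) Finset.univ_nonempty

theorem area_le_area_iff (hα : ∀ i, α i ∈ Set.Ioo 0 Real.pi) (P Q : ConvexPolygon α) :
    Q.area ≤ P.area ↔ pairing α Q.support Q.support ≤ pairing α P.support P.support := by
  rw [P.area_eq hα, Q.area_eq hα,
    ENNReal.ofReal_le_ofReal_iff (by linarith [P.pairing_self_pos])]
  constructor <;> intro h <;> linarith

theorem pairing_one_sub_eq_zero {P Q : ConvexPolygon α} (h : Q.perimeter = P.perimeter) :
    pairing α 1 (Q.support - P.support) = 0 := by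
  have := pairing_add_right α 1 P.support (Q.support - P.support)
  rw [add_sub_cancel, ← P.perimeter_eq, ← Q.perimeter_eq, h] at this
  linarith

/-- The first variation of area at r • 1 is a multiple of the perimeter functional, so only the
second-order term remains. -/
theorem pairing_self_eq_add_of_support_eq {P Q : ConvexPolygon α} {r : ℝ}
    (hP : P.support = r • 1) (h : Q.perimeter = P.perimeter) :
    pairing α Q.support Q.support = pairing α P.support P.support +
      pairing α (Q.support - P.support) (Q.support - P.support) := by
  have h1 := pairing_add_self α P.support (Q.support - P.support)
  have h2 : pairing α P.support (Q.support - P.support) = 0 := by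
    have h3 := pairing_one_sub_eq_zero h
    rw [pairing_comm] at h3 ⊢
    rw [hP, pairing_smul_right, ← hP, h3, mul_zero]
  rw [add_sub_cancel, h2] at h1
  linarith

theorem isOptimal_of_support_eq (hα : ∀ i, α i ∈ Set.Ioo 0 Real.pi)
    (hω : totalAngle α ≤ 2 * Real.pi) {P : ConvexPolygon α} {r : ℝ} (hP : P.support = r • 1) :
    P.IsOptimal := by
  intro Q hQ
  rw [area_le_area_iff hα, pairing_self_eq_add_of_support_eq hP hQ]
  linarith [pairing_self_nonpos α (Q.support - P.support) hα hω (pairing_one_sub_eq_zero hQ)]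

theorem signedLength_sub_eq_zero_of_isOptimal (hα : ∀ i, α i ∈ Set.Ioo 0 Real.pi)
    (hω : totalAngle α ≤ 2 * Real.pi) {P Q : ConvexPolygon α} {r : ℝ} (hP : P.support = r • 1)
    (h : Q.perimeter = P.perimeter) (hQ : Q.IsOptimal) (i : Fin n) :
    signedLength α (Q.support - P.support) i = 0 := by
  have h1 := pairing_one_sub_eq_zero h
  refine signedLength_eq_zero_of_pairing_self_eq_zero α _ hα hω h1 (le_antisymm ?_ ?_) i
  · exact pairing_self_nonpos α _ hα hω h1
  · have h2 := (area_le_area_iff hα Q P).1 (hQ P h.symm)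
    rw [pairing_self_eq_add_of_support_eq hP h] at h2
    linarith

theorem exists_circumscribed_perimeter_eq (hα : ∀ i, α i ∈ Set.Ioo 0 Real.pi) {L : ℝ}
    (hL : 0 < L) : ∃ P : ConvexPolygon α, ∃ r : ℝ, P.support = r • 1 ∧ P.perimeter = L := by
  have h := pairing_one_one_pos α hα
  refine ⟨circumscribed hα (div_pos hL h), _, rfl, ?_⟩
  rw [perimeter_eq]
  change pairing α 1 ((L / pairing α 1 1) • 1) = L
  rw [pairing_smul_right, div_mul_cancel₀ _ h.ne']

theorem perimeter_pos (P : ConvexPolygon α) : 0 < P.perimeter := by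
  rw [perimeter_eq, pairing_one_left]
  exact Finset.sum_pos (fun i _ => P.signedLength_pos i) Finset.univ_nonempty

/-- Positivity of supports and lengths is an open condition, so a small step ε along a positive
direction in the hyperplane remains a polygon of the same perimeter, while the form gains a positive
multiple of ε². -/
theorem not_isOptimal_of_support_eq (hα : ∀ i, α i ∈ Set.Ioo 0 Real.pi)
    (hω : 2 * Real.pi < totalAngle α) {P : ConvexPolygon α} {r : ℝ} (hP : P.support = r • 1) :
    ¬P.IsOptimal := by
  intro hopt
  obtain ⟨z, hz1, hz2⟩ := exists_pairing_self_pos α hα hω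
  have hev : ∀ᶠ ε : ℝ in nhdsWithin 0 (Set.Ioi 0),
      (∀ i, 0 < (P.support + ε • z) i) ∧ ∀ i, 0 < signedLength α (P.support + ε • z) i := by
    refine nhdsWithin_le_nhds (Filter.Eventually.and ?_ ?_) <;>
      refine Filter.eventually_all.2 fun i => ?_
    · have hc : Continuous fun ε : ℝ => (P.support + ε • z) i := by
        simp only [Pi.add_apply, Pi.smul_apply]
        fun_prop
      exact hc.continuousAt.eventually (lt_mem_nhds (by simpa using P.support_pos i))
    · have hc : Continuous fun ε : ℝ => signedLength α (P.support + ε • z) i := by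
        simp only [signedLength_add, signedLength_smul]
        fun_prop
      exact hc.continuousAt.eventually (lt_mem_nhds (by simpa using P.signedLength_pos i))
  obtain ⟨ε, ⟨h1, h2⟩, hε⟩ := (hev.and self_mem_nhdsWithin).exists
  let Q : ConvexPolygon α := ⟨P.support + ε • z, h1, h2⟩
  have hQP : Q.support - P.support = ε • z := add_sub_cancel_left _ _
  have hper : Q.perimeter = P.perimeter := by
    rw [Q.perimeter_eq, P.perimeter_eq, pairing_add_right, pairing_smul_right, hz1, mul_zero,
      add_zero]
  have h3 := (area_le_area_iff hα P Q).1 (hopt Q hper)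
  rw [pairing_self_eq_add_of_support_eq hP hper, hQP, pairing_smul_right,
    pairing_comm α (ε • z), pairing_smul_right] at h3
  have h4 : 0 < ε * (ε * pairing α z z) := mul_pos hε (mul_pos hε hz2)
  linarith

/-- At ω = 2π the ambiguity of polar angles on the cone is that of `Complex.arg`, and sides avoid
the apex, so developing along another ray is a rotation. -/
theorem preimage_side_eq (hω : totalAngle α = 2 * Real.pi) (P : ConvexPolygon α) (i : Fin n) :
    Cone.ofPlane (totalAngle α) 0 ⁻¹' P.side i =
      (fun z => Complex.exp (rayAngle α i * Complex.I) * z) '' P.devSide i := by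
  ext z
  simp only [side, Set.mem_preimage, Set.mem_image]
  refine exists_congr fun w => and_congr_right fun hw => ?_
  have hre : w.re = P.support i := by
    obtain ⟨a, b, -, -, hab, rfl⟩ := hw
    simp [startPoint, endPoint, ← add_mul, hab]
  have hw0 : w ≠ 0 := fun h => (P.support_pos i).ne' (by rw [← hre, h, Complex.zero_re])
  rw [Cone.ofPlane, Cone.ofPlane, Cone.polar_eq_polar_iff, zero_add, hω]
  constructor
  · rintro ⟨h1, h2⟩
    obtain ⟨k, hk⟩ := h2.resolve_left (by simpa using hw0)
    have hz := Complex.norm_mul_exp_arg_mul_I z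
    have hw' := Complex.norm_mul_exp_arg_mul_I w
    have h1' : ‖w‖ = ‖z‖ := congrArg NNReal.toReal h1
    rw [← hz, ← h1', hk]
    nth_rewrite 1 [← hw']
    rw [mul_left_comm, ← Complex.exp_add]
    congr 1
    rw [Complex.exp_eq_exp_iff_exists_int]
    exact ⟨-k, by push_cast; ring⟩
  · rintro rfl
    have hn : ‖Complex.exp (rayAngle α i * Complex.I) * w‖ = ‖w‖ := by
      rw [norm_mul, Complex.norm_exp_ofReal_mul_I, one_mul]
    refine ⟨NNReal.eq hn.symm, Or.inr ?_⟩
    have h1 := Complex.arg_mul_coe_angle (Complex.exp_ne_zero (rayAngle α i * Complex.I)) hw0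
    rw [Complex.arg_exp_mul_I, Real.Angle.coe_toIocMod, ← Real.Angle.coe_add,
      Real.Angle.angle_eq_iff_two_pi_dvd_sub] at h1
    obtain ⟨k, hk⟩ := h1
    exact ⟨k, by linarith⟩

/-- Translation by v adds Re(v exp(-iθ_i)) to the i-th support number, where θ_i is the ray angle;
these increments are exactly the vectors with all signed lengths zero. -/
theorem isTranslateOf_iff (hα : ∀ i, α i ∈ Set.Ioo 0 Real.pi) (hω : totalAngle α = 2 * Real.pi)
    (P Q : ConvexPolygon α) :
    Q.IsTranslateOf P ↔ ∀ i, signedLength α (Q.support - P.support) i = 0 := by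
  have hre : ∀ (P : ConvexPolygon α) (i : Fin n), ∀ w ∈ P.devSide i, w.re = P.support i := by
    rintro P i _ ⟨a, b, -, -, hab, rfl⟩
    simp [startPoint, endPoint, ← add_mul, hab]
  have hexp : ∀ i, Complex.exp (-(rayAngle α i * Complex.I)) *
      Complex.exp (rayAngle α i * Complex.I) = 1 := fun i => by
    rw [← Complex.exp_add, neg_add_cancel, Complex.exp_zero]
  simp only [IsTranslateOf, preimage_side_eq hω]
  constructor
  · rintro ⟨v, hv⟩
    refine signedLength_of_point α _ hα hω v fun i => ?_
    have hmem : Complex.exp (rayAngle α i * Complex.I) * startPoint α P.support i + v ∈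
        (fun z => Complex.exp (rayAngle α i * Complex.I) * z) '' Q.devSide i := by
      rw [hv i]
      exact ⟨_, ⟨_, left_mem_segment ℝ _ _, rfl⟩, rfl⟩
    obtain ⟨w, hw, hwe⟩ := hmem
    have h1 : w = startPoint α P.support i + v * Complex.exp (-(rayAngle α i * Complex.I)) := by
      linear_combination Complex.exp (-(rayAngle α i * Complex.I)) * hwe +
        (startPoint α P.support i - w) * hexp i
    have h2 := hre Q i w hw
    rw [h1, Complex.add_re] at h2
    have h3 : (startPoint α P.support i).re = P.support i := rfl
    rw [Pi.sub_apply, ← h2, h3, add_sub_cancel_left]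
  · intro h
    obtain ⟨v, hv, -⟩ := exists_point_of_signedLength_eq_zero α _ hα h
    refine ⟨v, fun i => ?_⟩
    have hs : startPoint α Q.support i =
        v * Complex.exp (-(rayAngle α i * Complex.I)) + startPoint α P.support i := by
      rw [← hv i, ← startPoint_add, sub_add_cancel]
    have he : endPoint α Q.support i =
        v * Complex.exp (-(rayAngle α i * Complex.I)) + endPoint α P.support i := by
      rw [← hv i, ← endPoint_eq_startPoint α _ (h i), ← endPoint_add, sub_add_cancel]
    rw [devSide, hs, he, ← segment_translate_image, Set.image_image, ← devSide, Set.image_image]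
    refine Set.image_congr fun z _ => ?_
    linear_combination v * hexp i

end ConvexPolygon

end

/-! ### The main theorem -/

open ConvexPolygon in
theorem mainTheorem3 {n : ℕ} [NeZero n] (α : Fin n → ℝ) (hα : ∀ i, α i ∈ Set.Ioo 0 Real.pi) :
    (∀ r : ℝ, 0 < r → ∃! P : ConvexPolygon α, P.IsCircumscribedAbout r) ∧
    (totalAngle α ≤ 2 * Real.pi →
      ∀ (P : ConvexPolygon α) (r : ℝ), P.IsCircumscribedAbout r → P.IsOptimal) ∧
    (totalAngle α < 2 * Real.pi →
      ∀ L : ℝ, 0 < L → ∃! P : ConvexPolygon α, P.perimeter = L ∧ P.IsOptimal) ∧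
    (totalAngle α = 2 * Real.pi →
      (∀ L : ℝ, 0 < L → ∃ P : ConvexPolygon α, P.perimeter = L ∧ P.IsOptimal) ∧
      ∀ P Q : ConvexPolygon α, P.IsOptimal →
        ((Q.perimeter = P.perimeter ∧ Q.IsOptimal) ↔ Q.IsTranslateOf P)) ∧
    (2 * Real.pi < totalAngle α →
      ∀ (P : ConvexPolygon α) (r : ℝ), P.IsCircumscribedAbout r → ¬ P.IsOptimal) := by
  refine ⟨fun r hr => ?_, fun hω P r hP => ?_, fun hω L hL => ?_, fun hω => ⟨fun L hL => ?_,
    fun P Q hP => ?_⟩, fun hω P r hP => ?_⟩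
  · refine ⟨circumscribed hα hr, (isCircumscribedAbout_iff hα _).2 ⟨hr, rfl⟩, fun Q hQ => ?_⟩
    exact ConvexPolygon.ext ((isCircumscribedAbout_iff hα Q).1 hQ).2
  · exact isOptimal_of_support_eq hα hω ((isCircumscribedAbout_iff hα P).1 hP).2
  · obtain ⟨P, r, hP, hPL⟩ := exists_circumscribed_perimeter_eq hα hL
    refine ⟨P, ⟨hPL, isOptimal_of_support_eq hα hω.le hP⟩, fun Q hQ => ?_⟩
    obtain ⟨v, hv, hv0⟩ := exists_point_of_signedLength_eq_zero α _ hα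
      (signedLength_sub_eq_zero_of_isOptimal hα hω.le hP (hQ.1.trans hPL.symm) hQ.2)
    refine ConvexPolygon.ext (sub_eq_zero.1 (funext fun i => ?_))
    have h := congrArg Complex.re (hv i)
    rw [hv0 hω, zero_mul] at h
    exact h
  · obtain ⟨P, r, hP, hPL⟩ := exists_circumscribed_perimeter_eq hα hL
    exact ⟨P, hPL, isOptimal_of_support_eq hα hω.le hP⟩
  · rw [isTranslateOf_iff hα hω]
    constructor
    · rintro ⟨hper, hQ⟩ i
      -- Both optimal polygons differ from the circumscribed one of the same perimeter by a vector
      -- with zero lengths, hence so do they from each other.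
      obtain ⟨P₀, r, hP₀, hL⟩ := exists_circumscribed_perimeter_eq hα P.perimeter_pos
      have h1 := signedLength_sub_eq_zero_of_isOptimal hα hω.le hP₀ hL.symm hP i
      have h2 := signedLength_sub_eq_zero_of_isOptimal hα hω.le hP₀ (hper.trans hL.symm) hQ i
      have h3 := signedLength_add α (Q.support - P.support) (P.support - P₀.support) i
      rw [sub_add_sub_cancel, h1, h2] at h3
      linarith
    · intro h
      -- A vector with zero lengths lies in the kernel of the form, so adding it changes neither
      -- perimeter nor area.
      have hz : ∀ x, pairing α x (Q.support - P.support) = 0 := fun x => by simp [pairing, h]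
      have hsum : P.support + (Q.support - P.support) = Q.support := add_sub_cancel _ _
      have hper : Q.perimeter = P.perimeter := by
        rw [Q.perimeter_eq, P.perimeter_eq, ← hsum, pairing_add_right, hz, add_zero]
      refine ⟨hper, fun R hR => (hP R (hR.trans hper)).trans ?_⟩
      rw [area_le_area_iff hα, ← hsum, pairing_add_self, hz, hz]
      linarith
  · exact not_isOptimal_of_support_eq hα hω ((isCircumscribedAbout_iff hα P).1 hP).2
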